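/- All graphs are finite, simple and undirected; $d_G(v)$ denotes the degree of a vertex $v$ in $G$. A \emph{caterpillar} is a tree that can be obtained from a path $P$ with at least one vertex by adding a (possibly empty) set of new vertices and making each new vertex adjacent to exactly one vertex of $P$; in particular a single vertex is a caterpillar. A \emph{forest of caterpillars} is a forest every connected component of which is a caterpillar. For an integer $k\ge 2$, a graph $G$ and a vertex $v$ of $G$ let \[ h_{k,G}(v)=\begin{cases} 1 & \text{if } d_G(v)=0,\\ 1 & \text{if } d_G(v)=1 \text{ and } d_G(w)\le k, \text{ where } w \text{ is the unique neighbour of } v,\\ 1-\dfrac{2}{(k+1)(d_G(w)+1)} & \text{if } d_G(v)=1 \text{ and } d_G(w)\ge k+1, \text{ where } w \text{ is the unique neighbour of } v,\\ \dfrac{2}{d_G(v)+1} & \text{if } d_G(v)\ge 2. \end{cases} \] \textbf{Theorem.} For every integer $k\ge 2$ and every graph $G$, there is a set $S\subseteq V(G)$ such that the induced subgraph $G[S]$ is a forest of caterpillars of maximum degree at most $k$ and \[ |S|\ \ge\ \sum_{v\in V(G)} h_{k,G}(v). \] -/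

import Mathlib

/-- A caterpillar: a tree that is obtained from a path `p` (with at least one vertex) by adding
a possibly empty set of new vertices, each of them made adjacent to one vertex of `p`. That is,
every vertex outside `p` has exactly one neighbour, and this neighbour lies on `p`. -/
def SimpleGraph.IsCaterpillar {V : Type*} (G : SimpleGraph V) : Prop :=
  G.IsTree ∧ ∃ (a b : V) (p : G.Walk a b), p.IsPath ∧
    ∀ x : V, x ∉ p.support → ∃ w ∈ p.support, G.neighborSet x = {w}

/-- A forest of caterpillars: a graph all of whose connected components are caterpillars. -/
def SimpleGraph.IsForestOfCaterpillars {V : Type*} (G : SimpleGraph V) : Prop :=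
  G.IsAcyclic ∧ ∀ C : G.ConnectedComponent, C.toSimpleGraph.IsCaterpillar

/-- The weight `h_{k,G}(v)`. If `v` has degree `1`, then `G.neighborFinset v` is a singleton
`{w}`, and the sum in the second branch is just its value at the neighbour `w` of `v`. -/
noncomputable def caterpillarWeight {V : Type*} [Fintype V] (k : ℕ) (G : SimpleGraph V)
    [DecidableRel G.Adj] (v : V) : ℝ :=
  if G.degree v = 0 then 1
  else if G.degree v = 1 then
    ∑ w ∈ G.neighborFinset v,
      if G.degree w ≤ k then (1 : ℝ)
      else 1 - 2 / (((k : ℝ) + 1) * ((G.degree w : ℝ) + 1))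
  else 2 / ((G.degree v : ℝ) + 1)

/-! All vertices of degree at most one go into `S`. Each pendant vertex charges its missing weight
to its neighbour, so a vertex of degree `d ≥ 2` with `l` pendant neighbours keeps the excess
`2/(d+1)` minus `l` penalties (`sum_caterpillarWeight_le`). If `l > k`, this is nonpositive and the
vertex is dropped. The others form a set `W`, and it suffices to choose in `W` an induced linear
forest in which each vertex has degree at most its cap `min 2 (k - l)`: the pendant vertices then
turn its paths into caterpillars.

The excess is at most `capWeight` of the cap and the degree inside `W` (`excess_le_capWeight`),
which leaves a statement about capped linear forests, `hasCapped_potential`. The total `capWeight`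
is not always attainable: a cherry, a path component whose middle vertex has cap one, has weight
`5/6 + 4/9 + 5/6 = 19/9`, but only two of its vertices can be kept. The potential therefore
subtracts `1/9` per cherry. This is free in the application, where the excess of a cherry centre is
at most `1/3` rather than `4/9`.

`hasCapped_potential` is proved by induction on the set. Deleting vertices raises the weights of
their neighbours; if these gains pay for the deleted weight and no new cherry gets a total above
`2`, induction applies. In a minimal counterexample (`IsStuck`) this excludes vertices of large
degree (`not_isBig`), then edges at cap-zero vertices (`degIn_eq_zero`), then degree three
(`degIn_ne_three`). With maximum degree two, removing all vertices of cap one and degree two leaves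
a large enough capped set (`elim`). -/

/-- The number of neighbours of `v` in the finite set `W`. -/
def SimpleGraph.degIn {V : Type*} (G : SimpleGraph V) [DecidableRel G.Adj] (W : Finset V) (v : V) :
    ℕ :=
  (W.filter (G.Adj v)).card

/-- `S` induces a linear forest in which the degree of every `v` is at most `t v`. Acyclicity is
expressed as `1`-degeneracy. -/
structure SimpleGraph.IsCapped {V : Type*} (G : SimpleGraph V) [DecidableRel G.Adj] (t : V → ℕ)
    (S : Finset V) : Prop where
  degIn_le : ∀ v ∈ S, G.degIn S v ≤ t v
  degenerate : ∀ T ⊆ S, T.Nonempty → ∃ v ∈ T, G.degIn T v ≤ 1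

/-! ### Numerical properties of the capped weight -/

/-- The weight of a vertex of degree `d` and degree cap `t`. -/
noncomputable def capWeight (t d : ℕ) : ℝ :=
  if d = 0 then 1
  else if t = 0 then (if d ≤ 3 then 1 / 6 else 2 / (3 * ((d : ℝ) + 1)))
  else if d = 1 then 5 / 6
  else if t = 1 then 4 / (3 * ((d : ℝ) + 1))
  else 2 / ((d : ℝ) + 1)

theorem capWeight_zero (t : ℕ) : capWeight t 0 = 1 := by simp [capWeight]

theorem capWeight_one {t : ℕ} (ht : 1 ≤ t) : capWeight t 1 = 5 / 6 := by
  have : t ≠ 0 := by omega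
  simp [capWeight, this]

theorem capWeight_cap_zero {d : ℕ} (h : 1 ≤ d) (h3 : d ≤ 3) : capWeight 0 d = 1 / 6 := by
  have : d ≠ 0 := by omega
  simp [capWeight, this, h3]

theorem capWeight_cap_zero_of_four_le {d : ℕ} (h : 4 ≤ d) :
    capWeight 0 d = 2 / (3 * ((d : ℝ) + 1)) := by
  have h0 : d ≠ 0 := by omega
  have h3 : ¬ d ≤ 3 := by omega
  simp [capWeight, h0, h3]

theorem capWeight_cap_one {d : ℕ} (h : 2 ≤ d) : capWeight 1 d = 4 / (3 * ((d : ℝ) + 1)) := by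
  have h0 : d ≠ 0 := by omega
  have h1 : d ≠ 1 := by omega
  simp [capWeight, h0, h1]

theorem capWeight_of_two_le {t d : ℕ} (ht : 2 ≤ t) (h : 2 ≤ d) :
    capWeight t d = 2 / ((d : ℝ) + 1) := by
  have h0 : d ≠ 0 := by omega
  have h1 : d ≠ 1 := by omega
  have h2 : t ≠ 0 := by omega
  have h3 : t ≠ 1 := by omega
  simp [capWeight, h0, h1, h2, h3]

theorem capWeight_succ_le (t d : ℕ) : capWeight t (d + 1) ≤ capWeight t d := by
  rcases Nat.eq_zero_or_pos d with rfl | hd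
  · rcases Nat.eq_zero_or_pos t with rfl | ht
    · rw [capWeight_zero, capWeight_cap_zero] <;> norm_num
    · rw [capWeight_zero, zero_add, capWeight_one ht]; norm_num
  rcases Nat.lt_trichotomy t 1 with h | rfl | h
  · obtain rfl : t = 0 := by omega
    rcases Nat.lt_trichotomy d 3 with h3 | rfl | h3
    · rw [capWeight_cap_zero (by omega) (by omega), capWeight_cap_zero (by omega) (by omega)]
    · rw [capWeight_cap_zero_of_four_le (by omega), capWeight_cap_zero (by omega) (by omega)]
      norm_num
    · rw [capWeight_cap_zero_of_four_le (by omega), capWeight_cap_zero_of_four_le (by omega)]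
      push_cast
      gcongr; linarith
  · rcases Nat.eq_or_lt_of_le hd with rfl | h2
    · rw [capWeight_cap_one (by omega), capWeight_one le_rfl]; norm_num
    · rw [capWeight_cap_one (by omega), capWeight_cap_one (by omega)]
      push_cast
      gcongr; linarith
  · rcases Nat.eq_or_lt_of_le hd with rfl | h2
    · rw [capWeight_of_two_le (by omega) (by omega), capWeight_one (by omega)]; norm_num
    · rw [capWeight_of_two_le (by omega) (by omega), capWeight_of_two_le (by omega) (by omega)]
      push_cast
      gcongr; linarith

theorem capWeight_antitone (t : ℕ) : Antitone (capWeight t) :=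
  antitone_nat_of_succ_le (capWeight_succ_le t)

theorem capWeight_le_one (t d : ℕ) : capWeight t d ≤ 1 :=
  (capWeight_antitone t (Nat.zero_le d)).trans_eq (capWeight_zero t)

theorem capWeight_le_of_one_le {t d : ℕ} (h : 1 ≤ d) : capWeight t d ≤ 5 / 6 := by
  refine (capWeight_antitone t h).trans ?_
  rcases Nat.eq_zero_or_pos t with rfl | ht
  · rw [capWeight_cap_zero] <;> norm_num
  · rw [capWeight_one ht]

theorem capWeight_cap_zero_le {d : ℕ} (h : 1 ≤ d) : capWeight 0 d ≤ 1 / 6 :=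
  (capWeight_antitone 0 h).trans_eq (capWeight_cap_zero le_rfl (by norm_num))

theorem capWeight_cap_one_le {d : ℕ} (h : 2 ≤ d) : capWeight 1 d ≤ 4 / 9 := by
  refine (capWeight_antitone 1 h).trans_eq ?_
  rw [capWeight_cap_one le_rfl]; norm_num

theorem capWeight_cap_one_le_of_three_le {d : ℕ} (h : 3 ≤ d) : capWeight 1 d ≤ 1 / 3 := by
  refine (capWeight_antitone 1 h).trans_eq ?_
  rw [capWeight_cap_one (by norm_num)]; norm_num

theorem capWeight_le_of_two_le {t d : ℕ} (h : 2 ≤ d) : capWeight t d ≤ 2 / 3 := by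
  rcases Nat.lt_trichotomy t 1 with h1 | rfl | h1
  · obtain rfl : t = 0 := by omega
    have := capWeight_cap_zero_le (d := d) (by omega)
    linarith
  · have := capWeight_cap_one_le h
    linarith
  · refine (capWeight_antitone t h).trans_eq ?_
    rw [capWeight_of_two_le (by omega) (by omega)]; norm_num

theorem capWeight_le_of_three_le {t d : ℕ} (h : 3 ≤ d) : capWeight t d ≤ 1 / 2 := by
  rcases Nat.lt_trichotomy t 1 with h1 | rfl | h1
  · obtain rfl : t = 0 := by omega
    have := capWeight_cap_zero_le (d := d) (by omega)
    linarith
  · have := capWeight_cap_one_le (d := d) (by omega)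
    linarith
  · refine (capWeight_antitone t h).trans_eq ?_
    rw [capWeight_of_two_le (by omega) (by omega)]; norm_num

/-- A vertex whose weight is exactly its degree times the increase of the weight on deleting one
neighbour, this increase being at most `1 / 9`. -/
def IsBig (t d : ℕ) : Prop := (t = 0 ∧ 4 ≤ d) ∨ (t = 1 ∧ 3 ≤ d) ∨ (2 ≤ t ∧ 4 ≤ d)

/-- The increase of the weight of a big vertex when one neighbour is deleted. -/
noncomputable def capDrop (t d : ℕ) : ℝ :=
  if t = 0 then (if d ≤ 3 then 0 else 2 / (3 * ((d : ℝ) * (d + 1))))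
  else if t = 1 then 4 / (3 * ((d : ℝ) * (d + 1)))
  else 2 / ((d : ℝ) * (d + 1))

theorem capDrop_nonneg (t d : ℕ) : 0 ≤ capDrop t d := by
  unfold capDrop; split_ifs <;> positivity

theorem IsBig.pos {t d : ℕ} (h : IsBig t d) : 1 ≤ d := by
  unfold IsBig at h; omega

theorem IsBig.capWeight_eq {t d : ℕ} (h : IsBig t d) : capWeight t d = d * capDrop t d := by
  have hd : (d : ℝ) ≠ 0 := by have := h.pos; positivity
  have hd1 : (d : ℝ) + 1 ≠ 0 := by positivity
  rcases h with ⟨rfl, h⟩ | ⟨rfl, h⟩ | ⟨ht, h⟩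
  · rw [capWeight_cap_zero_of_four_le h, capDrop, if_pos rfl, if_neg (by omega)]
    field_simp
  · rw [capWeight_cap_one (by omega), capDrop, if_neg (by omega), if_pos rfl]
    field_simp
  · rw [capWeight_of_two_le ht (by omega), capDrop, if_neg (by omega), if_neg (by omega)]
    field_simp

theorem IsBig.add_capDrop_le {t d : ℕ} (h : IsBig t (d + 1)) :
    capWeight t (d + 1) + capDrop t (d + 1) ≤ capWeight t d := by
  have hd : (0 : ℝ) < d := by
    have : 1 ≤ d := by unfold IsBig at h; omega
    exact_mod_cast this
  have h2 : (d : ℝ) + 1 + 1 ≠ 0 := by positivity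
  rcases h with ⟨rfl, h⟩ | ⟨rfl, h⟩ | ⟨ht, h⟩
  · rw [capWeight_cap_zero_of_four_le h, capDrop, if_pos rfl, if_neg (by omega)]
    rcases Nat.eq_or_lt_of_le h with h4 | h4
    · obtain rfl : d = 3 := by omega
      rw [capWeight_cap_zero] <;> norm_num
    · rw [capWeight_cap_zero_of_four_le (by omega)]
      push_cast
      apply le_of_eq
      field_simp
  · rw [capWeight_cap_one (by omega), capDrop, if_neg (by omega), if_pos rfl,
      capWeight_cap_one (by omega)]
    push_cast
    apply le_of_eq
    field_simp
  · rw [capWeight_of_two_le ht (by omega), capDrop, if_neg (by omega), if_neg (by omega),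
      capWeight_of_two_le ht (by omega)]
    push_cast
    apply le_of_eq
    field_simp

theorem IsBig.capDrop_le {t d : ℕ} (h : IsBig t d) : capDrop t d ≤ 1 / 9 := by
  rcases h with ⟨rfl, h⟩ | ⟨rfl, h⟩ | ⟨ht, h⟩
  · have h' : (4 : ℝ) ≤ d := by exact_mod_cast h
    rw [capDrop, if_pos rfl, if_neg (by omega), div_le_div_iff₀ (by positivity) (by norm_num)]
    nlinarith
  · have h' : (3 : ℝ) ≤ d := by exact_mod_cast h
    rw [capDrop, if_neg (by omega), if_pos rfl, div_le_div_iff₀ (by positivity) (by norm_num)]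
    nlinarith
  · have h' : (4 : ℝ) ≤ d := by exact_mod_cast h
    rw [capDrop, if_neg (by omega), if_neg (by omega),
      div_le_div_iff₀ (by positivity) (by norm_num)]
    nlinarith

/-- One deletion leaves degree at least three. This serves the cherry centres of degree at least
four in `not_isBig`. -/
theorem capWeight_add_capDrop_cap_one {d : ℕ} (h : 4 ≤ d) :
    capWeight 1 d + capDrop 1 d ≤ 1 / 3 := by
  obtain ⟨e, rfl⟩ : ∃ e, d = e + 1 := ⟨d - 1, by omega⟩
  exact (IsBig.add_capDrop_le (Or.inr (Or.inl ⟨rfl, by omega⟩))).trans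
    (capWeight_cap_one_le_of_three_le (by omega))

/-- The chord bound used to compare weights and drops. -/
theorem capWeight_le_add_capDrop {t d : ℕ} (h : IsBig t d ∨ (t = 0 ∧ 1 ≤ d)) :
    capWeight t d ≤ 1 / 6 + 5 / 2 * capDrop t d := by
  by_cases ht : t = 0
  · subst ht
    have h1 : 1 ≤ d := by unfold IsBig at h; omega
    have := capWeight_cap_zero_le h1
    have := capDrop_nonneg 0 d
    linarith
  have h : IsBig t d := h.resolve_right fun h => ht h.1
  have hd : (0 : ℝ) < d := by exact_mod_cast h.pos
  rcases h with ⟨rfl, h⟩ | ⟨rfl, h⟩ | ⟨ht, h⟩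
  · exact absurd rfl ht
  · rw [capWeight_cap_one (by omega), capDrop, if_neg (by omega), if_pos rfl]
    have : 1 / 6 + 5 / 2 * (4 / (3 * ((d : ℝ) * (d + 1)))) - 4 / (3 * ((d : ℝ) + 1))
        = ((d : ℝ) ^ 2 - 7 * d + 20) / (6 * (d * (d + 1))) := by
      field_simp; ring
    have h0 : 0 ≤ ((d : ℝ) ^ 2 - 7 * d + 20) / (6 * (d * (d + 1))) := by
      apply div_nonneg _ (by positivity)
      nlinarith [sq_nonneg ((d : ℝ) - 7 / 2)]
    linarith
  · rw [capWeight_of_two_le ht (by omega), capDrop, if_neg (by omega), if_neg (by omega)]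
    -- The line with slope `5/2` and intercept `1/6` meets the points (drop, weight) of the degrees
    -- 5 and 6, so the difference is nonnegative at every integer.
    have : 1 / 6 + 5 / 2 * (2 / ((d : ℝ) * (d + 1))) - 2 / ((d : ℝ) + 1)
        = ((d : ℝ) - 5) * (d - 6) / (6 * (d * (d + 1))) := by
      field_simp; ring
    have h0 : 0 ≤ ((d : ℝ) - 5) * (d - 6) / (6 * (d * (d + 1))) := by
      apply div_nonneg _ (by positivity)
      rcases Nat.lt_or_ge d 6 with h6 | h6
      · have : (d : ℝ) ≤ 5 := by exact_mod_cast (by omega : d ≤ 5)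
        nlinarith
      · have : (6 : ℝ) ≤ d := by exact_mod_cast h6
        nlinarith
    linarith

/-- Deleting a neighbour of a vertex of small degree and positive cap increases its weight by at
least `1 / 6`. -/
theorem capWeight_add_le_of_not_isBig {t d : ℕ} (ht : 1 ≤ t) (h : ¬ IsBig t (d + 1)) :
    capWeight t (d + 1) + 1 / 6 ≤ capWeight t d := by
  rcases Nat.eq_or_lt_of_le ht with rfl | ht
  · have : d ≤ 1 := by unfold IsBig at h; omega
    interval_cases d
    · rw [capWeight_zero, capWeight_one le_rfl]; norm_num
    · rw [capWeight_one le_rfl, capWeight_cap_one le_rfl]; norm_num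
  · have : d ≤ 2 := by unfold IsBig at h; omega
    interval_cases d
    · rw [capWeight_zero, capWeight_one (by omega)]; norm_num
    · rw [capWeight_one (by omega), capWeight_of_two_le (by omega) le_rfl]; norm_num
    · rw [capWeight_of_two_le (by omega) le_rfl, capWeight_of_two_le (by omega) (by omega)]
      norm_num

set_option linter.unusedSectionVars false

/-! ### Degrees inside vertex sets and capped sets -/

section CappedForests

variable {V : Type*} [DecidableEq V] {G : SimpleGraph V} [DecidableRel G.Adj] {t : V → ℕ}

namespace SimpleGraph

theorem degIn_mono {R W : Finset V} (h : R ⊆ W) (v : V) : G.degIn R v ≤ G.degIn W v :=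
  Finset.card_le_card (Finset.filter_subset_filter _ h)

theorem degIn_congr {R W : Finset V} {v : V} (h : ∀ x, G.Adj v x → (x ∈ R ↔ x ∈ W)) :
    G.degIn R v = G.degIn W v := by
  unfold degIn
  congr 1
  ext x
  simp only [Finset.mem_filter]
  constructor <;> rintro ⟨hx, ha⟩
  · exact ⟨(h x ha).1 hx, ha⟩
  · exact ⟨(h x ha).2 hx, ha⟩

theorem degIn_lt {R W : Finset V} (h : R ⊆ W) {v x : V} (hx : x ∈ W) (hxR : x ∉ R)
    (ha : G.Adj v x) : G.degIn R v + 1 ≤ G.degIn W v := by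
  apply Finset.card_lt_card
  refine Finset.ssubset_iff_subset_ne.2 ⟨Finset.filter_subset_filter _ h, fun he => hxR ?_⟩
  have : x ∈ W.filter (G.Adj v) := Finset.mem_filter.2 ⟨hx, ha⟩
  rw [← he] at this
  exact (Finset.mem_filter.1 this).1

theorem degIn_pos {W : Finset V} {v x : V} (hx : x ∈ W) (ha : G.Adj v x) : 1 ≤ G.degIn W v :=
  Finset.card_pos.2 ⟨x, Finset.mem_filter.2 ⟨hx, ha⟩⟩

theorem exists_of_degIn_pos {W : Finset V} {v : V} (h : 1 ≤ G.degIn W v) :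
    ∃ x ∈ W, G.Adj v x := by
  obtain ⟨x, hx⟩ := Finset.card_pos.1 h
  exact ⟨x, Finset.mem_filter.1 hx⟩

theorem eq_of_degIn_le_one {W : Finset V} {v x y : V} (h : G.degIn W v ≤ 1) (hx : x ∈ W)
    (hy : y ∈ W) (hvx : G.Adj v x) (hvy : G.Adj v y) : x = y :=
  Finset.card_le_one.1 h x (Finset.mem_filter.2 ⟨hx, hvx⟩) y (Finset.mem_filter.2 ⟨hy, hvy⟩)

theorem two_le_degIn {W : Finset V} {v x y : V} (hx : x ∈ W)
    (hy : y ∈ W) (hvx : G.Adj v x) (hvy : G.Adj v y) (hxy : x ≠ y) : 2 ≤ G.degIn W v := by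
  by_contra h
  exact hxy (eq_of_degIn_le_one (by omega) hx hy hvx hvy)

theorem eq_or_eq_of_degIn_le_two {W : Finset V} {v x y z : V} (h : G.degIn W v ≤ 2) (hx : x ∈ W)
    (hy : y ∈ W) (hz : z ∈ W) (hvx : G.Adj v x) (hvy : G.Adj v y) (hvz : G.Adj v z)
    (hxy : x ≠ y) : z = x ∨ z = y := by
  by_contra! hne
  have : ({x, y, z} : Finset V).card ≤ G.degIn W v := by
    apply Finset.card_le_card
    intro u hu
    simp only [Finset.mem_insert, Finset.mem_singleton] at hu
    rcases hu with rfl | rfl | rfl <;> simp [*]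
  rw [Finset.card_eq_three.2 ⟨x, y, z, hxy, hne.1.symm, hne.2.symm, rfl⟩] at this
  omega

theorem exists_ne_of_two_le_degIn {W : Finset V} {v : V} (h : 2 ≤ G.degIn W v) (x : V) :
    ∃ y ∈ W, G.Adj v y ∧ y ≠ x := by
  obtain ⟨y, hy, hne⟩ := Finset.exists_mem_ne (s := W.filter (G.Adj v)) (by unfold degIn at h; omega) x
  exact ⟨y, (Finset.mem_filter.1 hy).1, (Finset.mem_filter.1 hy).2, hne⟩

/-- Bounding a degree from above by listing all neighbours. -/
theorem degIn_le_card {W N : Finset V} {v : V} (h : ∀ x ∈ W, G.Adj v x → x ∈ N) :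
    G.degIn W v ≤ N.card :=
  Finset.card_le_card fun x hx =>
    h x (Finset.mem_filter.1 hx).1 (Finset.mem_filter.1 hx).2

/-- Some capped set of size at least `r` exists inside `W`. -/
def HasCapped (G : SimpleGraph V) [DecidableRel G.Adj] (t : V → ℕ) (W : Finset V) (r : ℝ) : Prop :=
  ∃ S ⊆ W, G.IsCapped t S ∧ r ≤ (S.card : ℝ)

theorem HasCapped.mono {W W' : Finset V} {r r' : ℝ} (h : G.HasCapped t W r) (hW : W ⊆ W')
    (hr : r' ≤ r) : G.HasCapped t W' r' := by
  obtain ⟨S, hS, hc, hr'⟩ := h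
  exact ⟨S, hS.trans hW, hc, hr.trans hr'⟩

theorem HasCapped.union {A B : Finset V} {r s : ℝ} (hA : G.HasCapped t A r)
    (hB : G.HasCapped t B s) (hd : Disjoint A B) (hn : ∀ a ∈ A, ∀ b ∈ B, ¬ G.Adj a b) :
    G.HasCapped t (A ∪ B) (r + s) := by
  obtain ⟨S, hSA, hS, hr⟩ := hA
  obtain ⟨T, hTB, hT, hs⟩ := hB
  refine ⟨S ∪ T, Finset.union_subset_union hSA hTB, ⟨?_, ?_⟩, ?_⟩
  · intro v hv
    rcases Finset.mem_union.1 hv with hv | hv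
    · rw [degIn_congr (W := S)]
      · exact hS.degIn_le v hv
      · intro x hx
        have : x ∉ T := fun hxT => hn v (hSA hv) x (hTB hxT) hx
        simp [this]
    · rw [degIn_congr (W := T)]
      · exact hT.degIn_le v hv
      · intro x hx
        have : x ∉ S := fun hxS => hn x (hSA hxS) v (hTB hv) hx.symm
        simp [this]
  · intro U hU hne
    by_cases hUS : (U ∩ S).Nonempty
    · obtain ⟨v, hv, hdv⟩ := hS.degenerate _ Finset.inter_subset_right hUS
      refine ⟨v, Finset.mem_of_mem_inter_left hv, ?_⟩
      rwa [degIn_congr (W := U ∩ S)]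
      intro x hx
      refine ⟨fun hxU => Finset.mem_inter.2 ⟨hxU, ?_⟩, fun h => Finset.mem_of_mem_inter_left h⟩
      refine (Finset.mem_union.1 (hU hxU)).resolve_right fun hxT => ?_
      exact hn v (hSA (Finset.mem_of_mem_inter_right hv)) x (hTB hxT) hx
    · refine hT.degenerate U (fun x hx => ?_) hne
      refine (Finset.mem_union.1 (hU hx)).resolve_left fun hxS => ?_
      exact hUS ⟨x, Finset.mem_inter.2 ⟨hx, hxS⟩⟩
  · rw [Finset.card_union_of_disjoint (hd.mono hSA hTB)]
    push_cast
    linarith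

theorem hasCapped_of_isCapped {S : Finset V} (h : G.IsCapped t S) : G.HasCapped t S S.card :=
  ⟨S, subset_rfl, h, le_rfl⟩

theorem hasCapped_empty : G.HasCapped t ∅ 0 :=
  ⟨∅, subset_rfl, ⟨by simp, by
    intro T hT hne
    rw [Finset.subset_empty.1 hT] at hne
    exact absurd hne (by simp)⟩, by simp⟩

/-- The weight of `v` in the subgraph induced by `W`. -/
noncomputable def wt (G : SimpleGraph V) [DecidableRel G.Adj] (t : V → ℕ) (W : Finset V) (v : V) :
    ℝ :=
  capWeight (t v) (G.degIn W v)

theorem wt_mono {R W : Finset V} (h : R ⊆ W) (v : V) : G.wt t W v ≤ G.wt t R v :=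
  capWeight_antitone _ (degIn_mono h v)

/-! ### Cherries and the potential -/

/-- `y x₁ x₂` is a path component of `G[R]` with middle vertex `y` of cap one and ends of positive
cap. -/
structure IsCherry (G : SimpleGraph V) [DecidableRel G.Adj] (t : V → ℕ) (R : Finset V)
    (y x₁ x₂ : V) : Prop where
  mem : y ∈ R
  mem₁ : x₁ ∈ R
  mem₂ : x₂ ∈ R
  ne : x₁ ≠ x₂
  cap : t y = 1
  cap₁ : 1 ≤ t x₁
  cap₂ : 1 ≤ t x₂
  adj₁ : G.Adj y x₁
  adj₂ : G.Adj y x₂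
  deg : G.degIn R y = 2
  deg₁ : G.degIn R x₁ = 1
  deg₂ : G.degIn R x₂ = 1

theorem IsCherry.symm {R : Finset V} {y x₁ x₂ : V} (h : G.IsCherry t R y x₁ x₂) :
    G.IsCherry t R y x₂ x₁ :=
  ⟨h.mem, h.mem₂, h.mem₁, h.ne.symm, h.cap, h.cap₂, h.cap₁, h.adj₂, h.adj₁, h.deg, h.deg₂, h.deg₁⟩

theorem IsCherry.eq_or_eq {R : Finset V} {y x₁ x₂ x : V} (h : G.IsCherry t R y x₁ x₂)
    (hx : x ∈ R) (ha : G.Adj y x) : x = x₁ ∨ x = x₂ :=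
  eq_or_eq_of_degIn_le_two h.deg.le h.mem₁ h.mem₂ hx h.adj₁ h.adj₂ ha h.ne

theorem IsCherry.eq_of_adj₁ {R : Finset V} {y x₁ x₂ x : V} (h : G.IsCherry t R y x₁ x₂)
    (hx : x ∈ R) (ha : G.Adj x₁ x) : x = y :=
  eq_of_degIn_le_one h.deg₁.le hx h.mem ha h.adj₁.symm

/-- The middle vertex of a cherry. -/
def IsCherryCenter (G : SimpleGraph V) [DecidableRel G.Adj] (t : V → ℕ) (R : Finset V)
    (y : V) : Prop :=
  ∃ x₁ x₂, G.IsCherry t R y x₁ x₂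

open Classical in
/-- The middle vertices of all cherries. -/
noncomputable def cherryCenters (G : SimpleGraph V) [DecidableRel G.Adj] (t : V → ℕ)
    (R : Finset V) : Finset V :=
  R.filter (G.IsCherryCenter t R)

theorem mem_cherryCenters {R : Finset V} {y : V} :
    y ∈ G.cherryCenters t R ↔ G.IsCherryCenter t R y := by
  simp only [cherryCenters, Finset.mem_filter, and_iff_right_iff_imp]
  rintro ⟨x₁, x₂, h⟩
  exact h.mem

/-- The total weight, with a penalty for every cherry. -/
noncomputable def potential (G : SimpleGraph V) [DecidableRel G.Adj] (t : V → ℕ) (R : Finset V) :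
    ℝ :=
  ∑ v ∈ R, G.wt t R v - (G.cherryCenters t R).card / 9

theorem IsCherry.filter_eq {R : Finset V} {y x₁ x₂ : V} (h : G.IsCherry t R y x₁ x₂) :
    R.filter (fun x => x = y ∨ G.Adj y x) = {y, x₁, x₂} := by
  ext x
  simp only [Finset.mem_filter, Finset.mem_insert, Finset.mem_singleton]
  constructor
  · rintro ⟨hx, rfl | ha⟩
    · exact Or.inl rfl
    · exact Or.inr (h.eq_or_eq hx ha)
  · rintro (rfl | rfl | rfl)
    · exact ⟨h.mem, Or.inl rfl⟩
    · exact ⟨h.mem₁, Or.inr h.adj₁⟩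
    · exact ⟨h.mem₂, Or.inr h.adj₂⟩

/-- Summing a nonnegative function over disjoint closed neighbourhoods. -/
theorem sum_sum_closedNbhd_le {R C : Finset V} (f : V → ℝ) (hf : ∀ v ∈ R, 0 ≤ f v)
    (hd : ∀ y ∈ C, ∀ y' ∈ C, ∀ x ∈ R, (x = y ∨ G.Adj y x) → (x = y' ∨ G.Adj y' x) → y = y') :
    ∑ y ∈ C, ∑ x ∈ R.filter (fun x => x = y ∨ G.Adj y x), f x ≤ ∑ x ∈ R, f x := by
  rw [← Finset.sum_biUnion]
  · apply Finset.sum_le_sum_of_subset_of_nonneg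
    · intro x hx
      obtain ⟨y, _, hx⟩ := Finset.mem_biUnion.1 hx
      exact (Finset.mem_filter.1 hx).1
    · intro v hv _
      exact hf v hv
  · intro y hy y' hy' hne
    refine Finset.disjoint_left.2 fun x hx hx' => hne ?_
    obtain ⟨hxR, hx⟩ := Finset.mem_filter.1 hx
    exact hd y hy y' hy' x hxR hx (Finset.mem_filter.1 hx').2

/-- Cherries are whole components, so two of them that meet coincide; hence their slacks can be
added up. -/
theorem IsCherry.center_unique {R : Finset V} {y x₁ x₂ y' x₁' x₂' x : V}
    (h : G.IsCherry t R y x₁ x₂) (h' : G.IsCherry t R y' x₁' x₂')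
    (hx : x = y ∨ x = x₁ ∨ x = x₂) (hx' : x = y' ∨ x = x₁' ∨ x = x₂') : y = y' := by
  have d := h.deg; have d₁ := h.deg₁; have d₂ := h.deg₂
  have d' := h'.deg; have d₁' := h'.deg₁; have d₂' := h'.deg₂
  have key : ∀ z, G.degIn R z = 1 → G.Adj y z → G.Adj y' z → y = y' := fun z hz ha ha' =>
    eq_of_degIn_le_one hz.le h.mem h'.mem ha.symm ha'.symm
  rcases hx with rfl | rfl | rfl <;> rcases hx' with hx' | hx' | hx' <;> subst hx' <;>
    first
    | rfl
    | omega
    | exact key _ d₁ h.adj₁ h'.adj₁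
    | exact key _ d₁ h.adj₁ h'.adj₂
    | exact key _ d₂ h.adj₂ h'.adj₁
    | exact key _ d₂ h.adj₂ h'.adj₂

/-- This is `5/6 + 5/6 + 4/9`, which exceeds the two vertices that can be kept by exactly the
penalty `1/9`. -/
theorem IsCherry.sum_wt {R : Finset V} {y x₁ x₂ : V} (h : G.IsCherry t R y x₁ x₂) :
    G.wt t R y + G.wt t R x₁ + G.wt t R x₂ = 19 / 9 := by
  rw [wt, wt, wt, h.deg, h.deg₁, h.deg₂, h.cap, capWeight_one h.cap₁, capWeight_one h.cap₂,
    capWeight_cap_one le_rfl]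
  norm_num

theorem IsCherry.sum_filter {R : Finset V} {y x₁ x₂ : V} (h : G.IsCherry t R y x₁ x₂)
    (f : V → ℝ) :
    ∑ x ∈ R.filter (fun x => x = y ∨ G.Adj y x), f x = f y + f x₁ + f x₂ := by
  rw [h.filter_eq, Finset.sum_insert, Finset.sum_pair h.ne, add_assoc]
  simp only [Finset.mem_insert, Finset.mem_singleton, not_or]
  exact ⟨h.adj₁.ne, h.adj₂.ne⟩

/-- A lower bound for the potential of `R` in terms of lower bounds for the weights. -/
theorem sum_le_potential {R : Finset V} (f : V → ℝ) (h₁ : ∀ v ∈ R, f v ≤ G.wt t R v)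
    (h₂ : ∀ y x₁ x₂, G.IsCherry t R y x₁ x₂ → f y + f x₁ + f x₂ ≤ 2) :
    ∑ v ∈ R, f v ≤ G.potential t R := by
  have key : ∑ y ∈ G.cherryCenters t R, ∑ x ∈ R.filter (fun x => x = y ∨ G.Adj y x),
      (G.wt t R x - f x) ≤ ∑ x ∈ R, (G.wt t R x - f x) := by
    apply sum_sum_closedNbhd_le
    · intro v hv
      linarith [h₁ v hv]
    · intro y hy y' hy' x hx hxy hxy'
      obtain ⟨x₁, x₂, h⟩ := mem_cherryCenters.1 hy
      obtain ⟨x₁', x₂', h'⟩ := mem_cherryCenters.1 hy'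
      have e : x ∈ ({y, x₁, x₂} : Finset V) := by
        rw [← h.filter_eq]; exact Finset.mem_filter.2 ⟨hx, hxy⟩
      have e' : x ∈ ({y', x₁', x₂'} : Finset V) := by
        rw [← h'.filter_eq]; exact Finset.mem_filter.2 ⟨hx, hxy'⟩
      exact h.center_unique h' (by simpa using e) (by simpa using e')
  -- A cherry weighs `19/9` and `f` sums to at most `2` on it, so its own slack pays its penalty.
  have low : ((G.cherryCenters t R).card : ℝ) / 9 ≤
      ∑ y ∈ G.cherryCenters t R, ∑ x ∈ R.filter (fun x => x = y ∨ G.Adj y x),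
        (G.wt t R x - f x) := by
    have : ((G.cherryCenters t R).card : ℝ) / 9 = ∑ y ∈ G.cherryCenters t R, (1 / 9 : ℝ) := by
      rw [Finset.sum_const, nsmul_eq_mul]; ring
    rw [this]
    apply Finset.sum_le_sum
    intro y hy
    obtain ⟨x₁, x₂, h⟩ := mem_cherryCenters.1 hy
    rw [h.sum_filter]
    have := h₂ y x₁ x₂ h
    have := h.sum_wt
    linarith
  rw [Finset.sum_sub_distrib] at key
  unfold potential
  linarith

theorem degenerate_empty : ∀ T ⊆ (∅ : Finset V), T.Nonempty → ∃ v ∈ T, G.degIn T v ≤ 1 := by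
  intro T hT hne
  rw [Finset.subset_empty.1 hT] at hne
  exact absurd hne (by simp)

theorem degenerate_insert {S : Finset V} {v : V}
    (hS : ∀ T ⊆ S, T.Nonempty → ∃ v ∈ T, G.degIn T v ≤ 1) (hv : G.degIn (insert v S) v ≤ 1) :
    ∀ T ⊆ insert v S, T.Nonempty → ∃ v ∈ T, G.degIn T v ≤ 1 := by
  intro T hT hne
  by_cases hvT : v ∈ T
  · exact ⟨v, hvT, (degIn_mono hT v).trans hv⟩
  · exact hS T ((Finset.subset_insert_iff_of_notMem hvT).1 hT) hne

theorem degIn_le_one_of_forall {W : Finset V} {v u : V} (h : ∀ x ∈ W, G.Adj v x → x = u) :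
    G.degIn W v ≤ 1 := by
  simpa using degIn_le_card (N := {u}) (fun x hx ha => by simpa using h x hx ha)

theorem degIn_le_two_of_forall {W : Finset V} {v u w : V}
    (h : ∀ x ∈ W, G.Adj v x → x = u ∨ x = w) : G.degIn W v ≤ 2 :=
  (degIn_le_card (N := {u, w}) (fun x hx ha => by simpa using h x hx ha)).trans Finset.card_le_two

theorem isCapped_pair {a b : V} (ha : 1 ≤ t a) (hb : 1 ≤ t b) : G.IsCapped t {a, b} := by
  have h1 : G.degIn {a, b} a ≤ 1 := degIn_le_one_of_forall (u := b) (by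
    intro x hx hax
    simp only [Finset.mem_insert, Finset.mem_singleton] at hx
    exact hx.resolve_left hax.ne')
  have h2 : G.degIn {a, b} b ≤ 1 := degIn_le_one_of_forall (u := a) (by
    intro x hx hax
    simp only [Finset.mem_insert, Finset.mem_singleton] at hx
    exact hx.resolve_right hax.ne')
  refine ⟨?_, ?_⟩
  · intro v hv
    simp only [Finset.mem_insert, Finset.mem_singleton] at hv
    rcases hv with rfl | rfl <;> omega
  · refine degenerate_insert ?_ h1
    have : G.degIn {b} b ≤ 1 := (degIn_mono (by simp) b).trans h2
    rw [← insert_empty_eq (β := Finset V)] at this ⊢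
    exact degenerate_insert degenerate_empty this

theorem HasCapped.pair {a b : V} (hab : a ≠ b) (ha : 1 ≤ t a) (hb : 1 ≤ t b) :
    G.HasCapped t {a, b} 2 := by
  have := hasCapped_of_isCapped (isCapped_pair (G := G) ha hb)
  rw [Finset.card_pair hab] at this
  exact_mod_cast this

/-! ### Minimal counterexamples and the reduction principle -/

/-- A set without cherries all of whose proper subsets satisfy the bound, while it does not. -/
structure IsStuck (G : SimpleGraph V) [DecidableRel G.Adj] (t : V → ℕ) (W : Finset V) : Prop where
  ih : ∀ R ⊂ W, G.HasCapped t R (G.potential t R)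
  noCherry : ∀ y x₁ x₂, ¬ G.IsCherry t W y x₁ x₂
  not_hasCapped : ¬ G.HasCapped t W (∑ v ∈ W, G.wt t W v)

theorem wt_le_five_sixths {W : Finset V} {v : V} (h : 1 ≤ G.degIn W v) : G.wt t W v ≤ 5 / 6 :=
  capWeight_le_of_one_le h

theorem wt_le_two_thirds {W : Finset V} {v : V} (h : 2 ≤ G.degIn W v) : G.wt t W v ≤ 2 / 3 :=
  capWeight_le_of_two_le h

theorem wt_le_half {W : Finset V} {v : V} (h : 3 ≤ G.degIn W v) : G.wt t W v ≤ 1 / 2 :=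
  capWeight_le_of_three_le h

theorem wt_le_of_cap_one {W : Finset V} {v : V} (ht : t v = 1) (h : 2 ≤ G.degIn W v) :
    G.wt t W v ≤ 4 / 9 := by
  rw [wt, ht]; exact capWeight_cap_one_le h

theorem wt_le_of_cap_one' {W : Finset V} {v : V} (ht : t v = 1) (h : 3 ≤ G.degIn W v) :
    G.wt t W v ≤ 1 / 3 := by
  rw [wt, ht]; exact capWeight_cap_one_le_of_three_le h

theorem wt_le_of_cap_zero {W : Finset V} {v : V} (ht : t v = 0) (h : 1 ≤ G.degIn W v) :
    G.wt t W v ≤ 1 / 6 := by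
  rw [wt, ht]; exact capWeight_cap_zero_le h

theorem wt_eq_one {R : Finset V} {v : V} (h : G.degIn R v = 0) : G.wt t R v = 1 := by
  rw [wt, h, capWeight_zero]

theorem wt_add_le_of_not_isBig {R W : Finset V} {v : V} (ht : 1 ≤ t v)
    (hb : ¬ IsBig (t v) (G.degIn W v)) (hR : G.degIn R v + 1 ≤ G.degIn W v) :
    G.wt t W v + 1 / 6 ≤ G.wt t R v := by
  obtain ⟨e, he⟩ : ∃ e, G.degIn W v = e + 1 := ⟨G.degIn W v - 1, by omega⟩
  rw [he] at hb
  rw [wt, wt, he]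
  exact (capWeight_add_le_of_not_isBig ht hb).trans (capWeight_antitone _ (by omega))

theorem wt_add_capDrop_le {R W : Finset V} {v : V}
    (hb : IsBig (t v) (G.degIn W v)) (hR : G.degIn R v + 1 ≤ G.degIn W v) :
    G.wt t W v + capDrop (t v) (G.degIn W v) ≤ G.wt t R v := by
  obtain ⟨e, he⟩ : ∃ e, G.degIn W v = e + 1 := ⟨G.degIn W v - 1, by omega⟩
  rw [he] at hb
  rw [wt, wt, he]
  exact hb.add_capDrop_le.trans (capWeight_antitone _ (by omega))

namespace IsStuck

variable {W : Finset V}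

/-- Since `W` has no cherry, one of the three vertices has a larger degree in `W` than in `R`. This
lowers the sum from `19/9` to at most `5/6 + 5/6 + 1/3 = 2` (centre) or `4/9 + 2/3 + 5/6` (an end).
-/
theorem cherry_sum_le_two (hW : G.IsStuck t W) {R : Finset V} (hR : R ⊆ W) {y x₁ x₂ : V}
    (h : G.IsCherry t R y x₁ x₂) : G.wt t W y + G.wt t W x₁ + G.wt t W x₂ ≤ 2 := by
  have d := degIn_mono (G := G) hR y
  have d₁ := degIn_mono (G := G) hR x₁
  have d₂ := degIn_mono (G := G) hR x₂
  rw [h.deg] at d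
  rw [h.deg₁] at d₁
  rw [h.deg₂] at d₂
  have w₁ := wt_le_five_sixths (t := t) d₁
  have w₂ := wt_le_five_sixths (t := t) d₂
  have w := wt_le_of_cap_one h.cap d
  by_cases c : 3 ≤ G.degIn W y
  · have := wt_le_of_cap_one' h.cap c
    linarith
  by_cases c₁ : 2 ≤ G.degIn W x₁
  · have := wt_le_two_thirds (t := t) c₁
    linarith
  by_cases c₂ : 2 ≤ G.degIn W x₂
  · have := wt_le_two_thirds (t := t) c₂
    linarith
  exact absurd ⟨hR h.mem, hR h.mem₁, hR h.mem₂, h.ne, h.cap, h.cap₁, h.cap₂, h.adj₁, h.adj₂,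
    by omega, by omega, by omega⟩ (hW.noCherry y x₁ x₂)

/-- The reduction principle: solve `T` directly, and the separated set `R` by induction. The
function `β` bounds the gains of the vertices of `R` from below. -/
theorem false_of_split (hW : G.IsStuck t W) {T R : Finset V} (hT : T ⊆ W) (hR : R ⊆ W)
    (hne : R ≠ W) (hd : Disjoint T R) (hn : ∀ a ∈ T, ∀ b ∈ R, ¬ G.Adj a b) {r : ℝ}
    (hr : G.HasCapped t T r) (β : V → ℝ)
    (h₁ : ∀ v ∈ R, β v ≠ 0 → G.wt t W v + β v ≤ G.wt t R v)
    (h₂ : ∀ y x₁ x₂, G.IsCherry t R y x₁ x₂ → β y ≠ 0 ∨ β x₁ ≠ 0 ∨ β x₂ ≠ 0 →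
      (G.wt t W y + β y) + (G.wt t W x₁ + β x₁) + (G.wt t W x₂ + β x₂) ≤ 2)
    (hs : ∑ v ∈ W \ R, G.wt t W v ≤ r + ∑ v ∈ R, β v) : False := by
  apply hW.not_hasCapped
  refine (hr.union (hW.ih R (hR.ssubset_of_ne hne)) hd hn).mono (Finset.union_subset hT hR) ?_
  have := sum_le_potential (G := G) (t := t) (R := R) (fun v => G.wt t W v + β v) (by
    intro v hv
    by_cases hβ : β v = 0
    · simpa [hβ] using wt_mono hR v
    · exact h₁ v hv hβ) (by
    intro y x₁ x₂ h
    by_cases hβ : β y ≠ 0 ∨ β x₁ ≠ 0 ∨ β x₂ ≠ 0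
    · exact h₂ y x₁ x₂ h hβ
    · push Not at hβ
      simpa [hβ] using hW.cherry_sum_le_two hR h)
  rw [Finset.sum_add_distrib] at this
  rw [← Finset.sum_sdiff hR]
  linarith

/-- The reduction principle for the deletion of `X`. -/
theorem false_of_delete (hW : G.IsStuck t W) {X : Finset V} (hX : X ⊆ W) (hne : X.Nonempty)
    (β : V → ℝ)
    (h₁ : ∀ v ∈ W \ X, β v ≠ 0 → G.wt t W v + β v ≤ G.wt t (W \ X) v)
    (h₂ : ∀ y x₁ x₂, G.IsCherry t (W \ X) y x₁ x₂ → β y ≠ 0 ∨ β x₁ ≠ 0 ∨ β x₂ ≠ 0 →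
      (G.wt t W y + β y) + (G.wt t W x₁ + β x₁) + (G.wt t W x₂ + β x₂) ≤ 2)
    (hs : ∑ v ∈ X, G.wt t W v ≤ ∑ v ∈ W \ X, β v) : False := by
  refine hW.false_of_split (T := ∅) (R := W \ X) (by simp) Finset.sdiff_subset ?_ (by simp)
    (by simp) (r := 0) hasCapped_empty β h₁ h₂ ?_
  · intro he
    obtain ⟨x, hx⟩ := hne
    have := hX hx
    rw [← he] at this
    exact (Finset.mem_sdiff.1 this).2 hx
  · rw [Finset.sdiff_sdiff_eq_self hX]
    linarith

/-- The reduction principle without gains. -/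
theorem false_of_split_zero (hW : G.IsStuck t W) {T Y : Finset V} (hY : Y ⊆ W) (hne : Y.Nonempty)
    (hT : T ⊆ Y) (hn : ∀ a ∈ T, ∀ b ∈ W, G.Adj a b → b ∈ Y) {r : ℝ}
    (hr : G.HasCapped t T r) (hs : ∑ v ∈ Y, G.wt t W v ≤ r) : False := by
  refine hW.false_of_split (T := T) (R := W \ Y) (hT.trans hY) Finset.sdiff_subset ?_ ?_ ?_ hr
    (fun _ => 0) (by simp) (by simp) ?_
  · intro he
    obtain ⟨x, hx⟩ := hne
    have := hY hx
    rw [← he] at this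
    exact (Finset.mem_sdiff.1 this).2 hx
  · exact Finset.disjoint_of_subset_left hT Finset.disjoint_sdiff
  · intro a ha b hb hab
    exact (Finset.mem_sdiff.1 hb).2 (hn a ha b (Finset.mem_sdiff.1 hb).1 hab)
  · rw [Finset.sdiff_sdiff_eq_self hY]
    simpa using hs

/-- A vertex of cap one and degree two has no pendant neighbour of positive cap. -/
theorem degIn_ne_one_of_adj (hW : G.IsStuck t W) {y x : V} (hy : y ∈ W) (hx : x ∈ W)
    (ht : t y = 1) (hd : G.degIn W y = 2) (ha : G.Adj y x) (hx1 : 1 ≤ t x) :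
    G.degIn W x ≠ 1 := by
  intro hdx
  obtain ⟨x₁, hx₁, ha₁, hne⟩ := exists_ne_of_two_le_degIn hd.ge x
  have hnb : ∀ u ∈ W, G.Adj y u → u = x₁ ∨ u = x := fun u hu h =>
    eq_or_eq_of_degIn_le_two hd.le hx₁ hx hu ha₁ ha h hne
  -- Keep `y` and `x` and discard `x₁`. The three weights add up to at most `4/9 + 5/6 + 2/3 < 2`,
  -- unless `x₁` is pendant of positive cap, and then there is a cherry.
  refine hW.false_of_split_zero (Y := {x₁, y, x}) (T := {y, x}) ?_ (by simp) (by simp) ?_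
    (HasCapped.pair ha.ne ht.ge hx1) ?_
  · simp [Finset.insert_subset_iff, *]
  · intro a ha' b hb hab
    simp only [Finset.mem_insert, Finset.mem_singleton] at ha' ⊢
    rcases ha' with rfl | rfl
    · rcases hnb b hb hab with h | h <;> simp [h]
    · exact Or.inr (Or.inl (eq_of_degIn_le_one hdx.le hb hy hab ha.symm))
  · rw [Finset.sum_insert (by simp [ha₁.ne', hne]), Finset.sum_pair ha.ne]
    have w := wt_le_of_cap_one (G := G) ht hd.ge
    have wx := wt_le_five_sixths (t := t) hdx.ge
    have d1 := degIn_pos (G := G) hy ha₁.symm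
    by_cases c : 2 ≤ G.degIn W x₁
    · have := wt_le_two_thirds (t := t) c
      linarith
    · by_cases c0 : t x₁ = 0
      · have := wt_le_of_cap_zero c0 d1
        linarith
      · exact absurd ⟨hy, hx₁, hx, hne, ht, by omega, hx1, ha₁, ha, hd, by omega, hdx⟩
          (hW.noCherry y x₁ x)

/-- The bound `11/6` leaves room for a gain of `1/6` at one vertex of the cherry. -/
theorem cherry_sum_le (hW : G.IsStuck t W) {R : Finset V} (hR : R ⊆ W) {y x₁ x₂ : V}
    (h : G.IsCherry t R y x₁ x₂) (h₁ : 2 ≤ G.degIn W x₁) :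
    G.wt t W y + G.wt t W x₁ + G.wt t W x₂ ≤ 11 / 6 := by
  have d := degIn_mono (G := G) hR y
  have d₂ := degIn_mono (G := G) hR x₂
  rw [h.deg] at d
  rw [h.deg₂] at d₂
  have w₁ := wt_le_two_thirds (t := t) h₁
  have w₂ := wt_le_five_sixths (t := t) d₂
  have w := wt_le_of_cap_one h.cap d
  by_cases c : 3 ≤ G.degIn W y
  · have := wt_le_of_cap_one' h.cap c
    linarith
  · have := hW.degIn_ne_one_of_adj (hR h.mem) (hR h.mem₂) h.cap (by omega) h.adj₂ h.cap₂
    have := wt_le_two_thirds (G := G) (t := t) (W := W) (v := x₂) (by omega)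
    linarith

end IsStuck

theorem degIn_sdiff_singleton {W : Finset V} {v z : V} (hz : z ∈ W) (ha : G.Adj v z) :
    G.degIn (W \ {z}) v + 1 = G.degIn W v := by
  have : W.filter (G.Adj v) = insert z ((W \ {z}).filter (G.Adj v)) := by
    ext x
    by_cases hx : x = z
    · subst hx; simp [hz, ha]
    · simp [hx]
  rw [degIn, degIn, this, Finset.card_insert_of_notMem (by simp)]

theorem degIn_sdiff_singleton_of_not_adj {W : Finset V} {v z : V} (ha : ¬ G.Adj v z) :
    G.degIn (W \ {z}) v = G.degIn W v := by
  apply degIn_congr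
  intro x hx
  have : x ≠ z := by rintro rfl; exact ha hx
  simp [this]

/-- A maximal independent subset. -/
theorem exists_maximal_independent (G : SimpleGraph V) (Z : Finset V) :
    ∃ I ⊆ Z, (∀ a ∈ I, ∀ b ∈ I, ¬ G.Adj a b) ∧ ∀ z ∈ Z, z ∈ I ∨ ∃ i ∈ I, G.Adj i z := by
  induction Z using Finset.induction_on with
  | empty => exact ⟨∅, by simp⟩
  | insert a Z _ ih =>
    obtain ⟨I, hI, hind, hdom⟩ := ih
    by_cases h : ∃ i ∈ I, G.Adj i a
    · refine ⟨I, hI.trans (Finset.subset_insert _ _), hind, fun z hz => ?_⟩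
      rcases Finset.mem_insert.1 hz with rfl | hz
      · exact Or.inr h
      · exact hdom z hz
    · push Not at h
      refine ⟨insert a I, Finset.insert_subset_insert _ hI, ?_, fun z hz => ?_⟩
      · intro x hx y hy hxy
        rcases Finset.mem_insert.1 hx with ex | hx <;> rcases Finset.mem_insert.1 hy with ey | hy
        · exact hxy.ne (ex.trans ey.symm)
        · exact h y hy (ex ▸ hxy.symm)
        · exact h x hx (ey ▸ hxy)
        · exact hind x hx y hy hxy
      · rcases Finset.mem_insert.1 hz with rfl | hz
        · exact Or.inl (Finset.mem_insert_self _ _)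
        · rcases hdom z hz with hz | ⟨i, hi, hiz⟩
          · exact Or.inl (Finset.mem_insert_of_mem hz)
          · exact Or.inr ⟨i, Finset.mem_insert_of_mem hi, hiz⟩

theorem sum_biUnion_le_of_nonneg {ι : Type*} [DecidableEq ι] (I : Finset ι) (N : ι → Finset V)
    (f : V → ℝ) (hf : ∀ v, 0 ≤ f v) : ∑ v ∈ I.biUnion N, f v ≤ ∑ i ∈ I, ∑ v ∈ N i, f v := by
  induction I using Finset.induction_on with
  | empty => simp
  | insert a I ha ih =>
    rw [Finset.biUnion_insert, Finset.sum_insert ha]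
    have h := Finset.sum_union_inter (s₁ := N a) (s₂ := I.biUnion N) (f := f)
    have h0 : 0 ≤ ∑ v ∈ N a ∩ I.biUnion N, f v := Finset.sum_nonneg fun v _ => hf v
    linarith

theorem capWeight_nonneg (t d : ℕ) : 0 ≤ capWeight t d := by
  unfold capWeight; split_ifs <;> positivity

theorem wt_nonneg (W : Finset V) (v : V) : 0 ≤ G.wt t W v := capWeight_nonneg _ _

/-! ### Exclusion of big vertices -/

namespace IsStuck

variable {W : Finset V}

/-- By `hc` the gaining vertex `x` cannot be the centre, so it is an end whose degree dropped to
one. Then `cherry_sum_le` applies: `11/6 + 1/6 = 2`. -/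
theorem cherry_gain_single (hW : G.IsStuck t W) {R : Finset V} (hR : R ⊆ W) {y x₁ x₂ x : V}
    (h : G.IsCherry t R y x₁ x₂) (hx : G.degIn R x + 1 ≤ G.degIn W x)
    (hc : ¬ (t x = 1 ∧ G.degIn R x = 2)) {β : V → ℝ} (hβ : β x ≤ 1 / 6)
    (h0 : ∀ v, 1 ≤ t v → G.degIn R v ≠ 0 → β v ≠ 0 → v = x)
    (hne : β y ≠ 0 ∨ β x₁ ≠ 0 ∨ β x₂ ≠ 0) :
    (G.wt t W y + β y) + (G.wt t W x₁ + β x₁) + (G.wt t W x₂ + β x₂) ≤ 2 := by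
  have hy : β y = 0 := by
    by_contra hy
    obtain rfl := h0 y h.cap.ge (by have := h.deg; omega) hy
    exact hc ⟨h.cap, h.deg⟩
  have e₁ := h0 x₁ h.cap₁ (by have := h.deg₁; omega)
  have e₂ := h0 x₂ h.cap₂ (by have := h.deg₂; omega)
  rcases hne with hne | hne | hne
  · exact absurd hy hne
  · obtain rfl := e₁ hne
    have h2 : β x₂ = 0 := by
      by_contra h2
      exact h.ne (e₂ h2).symm
    have := hW.cherry_sum_le hR h (by have := h.deg₁; omega)
    linarith
  · obtain rfl := e₂ hne
    have h1 : β x₁ = 0 := by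
      by_contra h1
      exact h.ne (e₁ h1)
    have := hW.cherry_sum_le hR h.symm (by have := h.deg₂; omega)
    linarith

/-- A vertex of cap one and degree three with a pendant neighbour has no other neighbour that is
pendant, or of cap and degree two. -/
theorem not_pendant_of_adj (hW : G.IsStuck t W) {y x₁ x₂ : V} (hy : y ∈ W) (hx₁ : x₁ ∈ W)
    (hx₂ : x₂ ∈ W) (ht : t y = 1) (hd : G.degIn W y = 3) (ha₁ : G.Adj y x₁) (ha₂ : G.Adj y x₂)
    (hne : x₁ ≠ x₂) (ht₂ : 1 ≤ t x₂) (hd₂ : G.degIn W x₂ = 1)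
    (h₁ : (1 ≤ t x₁ ∧ G.degIn W x₁ = 1) ∨ (2 ≤ t x₁ ∧ G.degIn W x₁ = 2)) : False := by
  have r₁ := degIn_sdiff_singleton hy ha₁.symm
  have r₂ := degIn_sdiff_singleton hy ha₂.symm
  have b₁ : ¬ IsBig (t x₁) (G.degIn W x₁) := by unfold IsBig; omega
  have b₂ : ¬ IsBig (t x₂) (G.degIn W x₂) := by unfold IsBig; omega
  have m₁ : x₁ ∈ W \ {y} := by simp [hx₁, ha₁.ne']
  have m₂ : x₂ ∈ W \ {y} := by simp [hx₂, ha₂.ne']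
  have hβ : ∀ v, (if v = x₁ then (1 / 6 : ℝ) else 0) + (if v = x₂ then 1 / 6 else 0) ≠ 0 →
      v = x₁ ∨ v = x₂ := by
    intro v hv
    by_contra! h
    simp [h] at hv
  -- The weight of `y` is at most `1/3`, repaid by `1/6` at each of `x₁` and `x₂`. As `x₂` becomes
  -- isolated, a cherry can contain only `x₁`.
  refine hW.false_of_delete (X := {y}) (by simpa using hy) (by simp)
    (fun v => (if v = x₁ then 1 / 6 else 0) + (if v = x₂ then 1 / 6 else 0)) ?_ ?_ ?_
  · intro v hv hv0
    rcases hβ v hv0 with rfl | rfl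
    · simpa [hne] using wt_add_le_of_not_isBig (by omega) b₁ r₁.le
    · simpa [hne.symm] using wt_add_le_of_not_isBig ht₂ b₂ r₂.le
  · intro s a b h hs
    refine hW.cherry_gain_single
      (β := fun v => (if v = x₁ then 1 / 6 else 0) + (if v = x₂ then 1 / 6 else 0))
      Finset.sdiff_subset h r₁.le (by omega) ?_ ?_ hs
    · simp [hne]
    intro v _ hv hv0
    refine (hβ v hv0).resolve_right ?_
    rintro rfl
    omega
  · rw [Finset.sum_singleton, Finset.sum_add_distrib, Finset.sum_ite_eq', Finset.sum_ite_eq',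
      if_pos m₁, if_pos m₂]
    have := wt_le_of_cap_one' (G := G) ht hd.ge
    linarith

/-- A neighbour of positive cap of a vertex of cap zero and small degree is big. -/
theorem isBig_of_adj (hW : G.IsStuck t W) {z x : V} (hz : z ∈ W) (hx : x ∈ W) (ht : t z = 0)
    (ha : G.Adj z x) (hx1 : 1 ≤ t x) : IsBig (t x) (G.degIn W x) := by
  by_contra hb
  have r := degIn_sdiff_singleton hz ha.symm
  have m : x ∈ W \ {z} := by simp [hx, ha.ne']
  refine hW.false_of_delete (X := {z}) (by simpa using hz) (by simp)
    (fun v => if v = x then 1 / 6 else 0) ?_ ?_ ?_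
  · intro v hv hv0
    obtain rfl : v = x := by by_contra h; simp [h] at hv0
    simpa using wt_add_le_of_not_isBig hx1 hb r.le
  · intro s a b h hs
    refine hW.cherry_gain_single (β := fun v => if v = x then 1 / 6 else 0)
      Finset.sdiff_subset h r.le ?_ ?_ ?_ hs
    · unfold IsBig at hb; omega
    · simp
    · intro v _ _ hv0
      by_contra h
      simp [h] at hv0
  · rw [Finset.sum_singleton, Finset.sum_ite_eq', if_pos m]
    exact wt_le_of_cap_zero ht (degIn_pos hx ha)

/-- Otherwise the gains at the neighbours would repay the weight of `z`, at most `1/6`. No cherry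
interferes: its ends are too small to be big neighbours of `z`, and a gaining centre would have
degree three and two pendant neighbours in `W`, against `not_pendant_of_adj`. -/
theorem sum_capDrop_lt (hW : G.IsStuck t W) {z : V} (hz : z ∈ W) (ht : t z = 0)
    (hd : 1 ≤ G.degIn W z) :
    ∑ x ∈ W.filter (G.Adj z), capDrop (t x) (G.degIn W x) < 1 / 6 := by
  by_contra! hge
  have hbig : ∀ v ∈ W, (if G.Adj z v then capDrop (t v) (G.degIn W v) else 0) ≠ 0 →
      G.Adj z v ∧ IsBig (t v) (G.degIn W v) := by
    intro v hv hv0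
    have ha : G.Adj z v := by by_contra h; simp [h] at hv0
    refine ⟨ha, ?_⟩
    by_cases htv : 1 ≤ t v
    · exact hW.isBig_of_adj hz hv ht ha htv
    · left
      rw [if_pos ha] at hv0
      refine ⟨by omega, ?_⟩
      by_contra h
      apply hv0
      rw [capDrop, if_pos (by omega), if_pos (by omega)]
  refine hW.false_of_delete (X := {z}) (by simpa using hz) (by simp)
    (fun v => if G.Adj z v then capDrop (t v) (G.degIn W v) else 0) ?_ ?_ ?_
  · intro v hv hv0
    obtain ⟨ha, hb⟩ := hbig v (Finset.mem_sdiff.1 hv).1 hv0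
    simp only [if_pos ha]
    exact wt_add_capDrop_le hb (degIn_sdiff_singleton hz ha.symm).le
  · intro y x₁ x₂ h hs
    exfalso
    have hsub : W \ {z} ⊆ W := Finset.sdiff_subset
    have hend : ∀ x ∈ W \ {z}, 1 ≤ t x → G.degIn (W \ {z}) x = 1 → ¬ G.Adj z x := by
      intro x hx htx hdx ha
      have := degIn_sdiff_singleton hz ha.symm
      have := hW.isBig_of_adj hz (hsub hx) ht ha htx
      unfold IsBig at this
      omega
    have n₁ := hend x₁ h.mem₁ h.cap₁ h.deg₁
    have n₂ := hend x₂ h.mem₂ h.cap₂ h.deg₂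
    simp only [if_neg n₁, if_neg n₂, ne_eq, not_true_eq_false, or_false] at hs
    obtain ⟨ha, hb⟩ := hbig y (hsub h.mem) hs
    have dy := degIn_sdiff_singleton hz ha.symm
    rw [h.deg] at dy
    have d₁ := degIn_sdiff_singleton_of_not_adj (W := W) (fun e : G.Adj x₁ z => n₁ e.symm)
    have d₂ := degIn_sdiff_singleton_of_not_adj (W := W) (fun e : G.Adj x₂ z => n₂ e.symm)
    rw [h.deg₁] at d₁
    rw [h.deg₂] at d₂
    exact hW.not_pendant_of_adj (hsub h.mem) (hsub h.mem₁) (hsub h.mem₂) h.cap dy.symm h.adj₁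
      h.adj₂ h.ne h.cap₂ d₂.symm (Or.inl ⟨h.cap₁, d₁.symm⟩)
  · rw [Finset.sum_singleton]
    refine (wt_le_of_cap_zero ht hd).trans (hge.trans_eq ?_)
    rw [← Finset.sum_filter]
    refine Finset.sum_congr ?_ fun _ _ => rfl
    ext x
    simp only [Finset.mem_filter, Finset.mem_sdiff, Finset.mem_singleton]
    constructor
    · rintro ⟨hx, ha⟩; exact ⟨⟨hx, ha.ne'⟩, ha⟩
    · rintro ⟨⟨hx, _⟩, ha⟩; exact ⟨hx, ha⟩

/-- This is the bill for isolating `z` in `not_isBig`: the weights of its at most two neighbours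
other than `v`, plus one gain `m` forgone for each of them and for `z`. By the chord bound and
`sum_capDrop_lt` it is at most `3/4 + m/2`, and isolation brings `5/6`. -/
theorem sum_nbrs_le (hW : G.IsStuck t W) {z v : V} (hz : z ∈ W) (hv : v ∈ W) (ht : t z = 0)
    (hd : G.degIn W z ≤ 3) (ha : G.Adj z v) {m : ℝ} (hm : m = capDrop (t v) (G.degIn W v))
    (hm9 : m ≤ 1 / 9) :
    ∑ x ∈ W.filter (G.Adj z) \ {v}, (G.wt t W x + m) + m ≤ 5 / 6 := by
  have hlt := hW.sum_capDrop_lt hz ht (degIn_pos hv ha)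
  have hvm : v ∈ W.filter (G.Adj z) := Finset.mem_filter.2 ⟨hv, ha⟩
  have hsplit := Finset.sum_sdiff (Finset.singleton_subset_iff.2 hvm)
    (f := fun x => capDrop (t x) (G.degIn W x))
  rw [Finset.sum_singleton, ← hm] at hsplit
  have hm0 : 0 ≤ m := hm ▸ capDrop_nonneg _ _
  have hcard : (W.filter (G.Adj z) \ {v}).card ≤ 2 := by
    rw [Finset.card_sdiff_of_subset (Finset.singleton_subset_iff.2 hvm), Finset.card_singleton]
    unfold degIn at hd
    omega
  have hcard' : ((W.filter (G.Adj z) \ {v}).card : ℝ) ≤ 2 := by exact_mod_cast hcard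
  have hle : ∑ x ∈ W.filter (G.Adj z) \ {v}, (G.wt t W x + m) ≤
      ∑ x ∈ W.filter (G.Adj z) \ {v}, ((1 / 6 + m) + 5 / 2 * capDrop (t x) (G.degIn W x)) := by
    apply Finset.sum_le_sum
    intro x hx
    obtain ⟨hxW, hax⟩ := Finset.mem_filter.1 (Finset.mem_sdiff.1 hx).1
    have : G.wt t W x ≤ 1 / 6 + 5 / 2 * capDrop (t x) (G.degIn W x) := by
      apply capWeight_le_add_capDrop
      by_cases htx : 1 ≤ t x
      · exact Or.inl (hW.isBig_of_adj hz hxW ht hax htx)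
      · exact Or.inr ⟨by omega, degIn_pos hz hax.symm⟩
    linarith
  have he : ∑ x ∈ W.filter (G.Adj z) \ {v}, ((1 / 6 + m) + 5 / 2 * capDrop (t x) (G.degIn W x)) =
      (W.filter (G.Adj z) \ {v}).card * (1 / 6 + m) +
        5 / 2 * ∑ x ∈ W.filter (G.Adj z) \ {v}, capDrop (t x) (G.degIn W x) := by
    rw [Finset.sum_add_distrib, Finset.sum_const, nsmul_eq_mul, ← Finset.mul_sum]
  rw [he] at hle
  have := mul_le_mul_of_nonneg_right hcard' (by linarith : 0 ≤ 1 / 6 + m)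
  linarith

/-- There is no big vertex. -/
theorem not_isBig (hW : G.IsStuck t W) : ∀ v ∈ W, ¬ IsBig (t v) (G.degIn W v) := by
  classical
  by_contra! hex
  -- Choose a big vertex of minimal drop `m`. Its weight is its degree times `m`, so deleting it is
  -- paid for once every neighbour gains `m`; big neighbours do by minimality, and small neighbours
  -- of positive cap gain `1/6`.
  obtain ⟨v₀, hv₀, hmin⟩ := Finset.exists_min_image
    (W.filter fun v => IsBig (t v) (G.degIn W v)) (fun v => capDrop (t v) (G.degIn W v))
    (by obtain ⟨v, hv, hb⟩ := hex; exact ⟨v, Finset.mem_filter.2 ⟨hv, hb⟩⟩)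
  obtain ⟨hv₀, hb₀⟩ := Finset.mem_filter.1 hv₀
  have hmin : ∀ v ∈ W, IsBig (t v) (G.degIn W v) →
      capDrop (t v₀) (G.degIn W v₀) ≤ capDrop (t v) (G.degIn W v) := fun v hv hb =>
    hmin v (Finset.mem_filter.2 ⟨hv, hb⟩)
  obtain ⟨m, hm⟩ : ∃ m, m = capDrop (t v₀) (G.degIn W v₀) := ⟨_, rfl⟩
  have hm9 : m ≤ 1 / 9 := hm ▸ hb₀.capDrop_le
  have hm0 : 0 ≤ m := hm ▸ capDrop_nonneg _ _
  rw [← hm] at hmin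
  -- Cap-zero neighbours of degree at most three need not gain. For a maximal independent set `I` of
  -- them, all neighbours of `I` are deleted too: members of `I` become isolated and the other such
  -- vertices disappear.
  obtain ⟨I, hI, hind, hdom⟩ := exists_maximal_independent G
    (W.filter fun z => G.Adj v₀ z ∧ t z = 0 ∧ G.degIn W z ≤ 3)
  have hI : ∀ z ∈ I, z ∈ W ∧ G.Adj v₀ z ∧ t z = 0 ∧ G.degIn W z ≤ 3 := fun z hz =>
    Finset.mem_filter.1 (hI hz)
  let N : V → Finset V := fun z => W.filter (G.Adj z) \ {v₀}
  let X : Finset V := insert v₀ (I.biUnion N)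
  have hXW : X ⊆ W := by
    intro x hx
    rcases Finset.mem_insert.1 hx with rfl | hx
    · exact hv₀
    · obtain ⟨z, _, hx⟩ := Finset.mem_biUnion.1 hx
      exact (Finset.mem_filter.1 (Finset.mem_sdiff.1 hx).1).1
  have hv₀X : v₀ ∈ X := Finset.mem_insert_self _ _
  have hNX : ∀ z ∈ I, ∀ x ∈ W, G.Adj z x → x ∈ X := by
    intro z hz x hx ha
    by_cases h : x = v₀
    · rw [h]; exact hv₀X
    · exact Finset.mem_insert_of_mem (Finset.mem_biUnion.2 ⟨z, hz, by simp [N, hx, ha, h]⟩)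
  have hIX : ∀ z ∈ I, z ∉ X := by
    intro z hz hzX
    rcases Finset.mem_insert.1 hzX with rfl | hzX
    · exact (hI z hz).2.1.ne rfl
    · obtain ⟨z', hz', h⟩ := Finset.mem_biUnion.1 hzX
      exact hind z' hz' z hz (Finset.mem_filter.1 (Finset.mem_sdiff.1 h).1).2
  have hsub : W \ X ⊆ W := Finset.sdiff_subset
  have hlt : ∀ v, G.Adj v₀ v → G.degIn (W \ X) v + 1 ≤ G.degIn W v := fun v ha =>
    degIn_lt hsub hv₀ (by simp [hv₀X]) ha.symm
  have hpos : ∀ v, 1 ≤ t v → v ∉ I := by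
    intro v hv hvI
    have := (hI v hvI).2.2.1
    omega
  refine hW.false_of_delete (X := X) hXW ⟨v₀, hv₀X⟩
    (fun v => if v ∈ I then 5 / 6 else if G.Adj v₀ v then m else 0) ?_ ?_ ?_
  · intro v hv hv0
    obtain ⟨hvW, hvX⟩ := Finset.mem_sdiff.1 hv
    by_cases hvI : v ∈ I
    · simp only [if_pos hvI]
      have h0 : G.degIn (W \ X) v = 0 := by
        by_contra h
        obtain ⟨x, hx, ha⟩ := exists_of_degIn_pos (Nat.pos_of_ne_zero h)
        obtain ⟨hxW, hxX⟩ := Finset.mem_sdiff.1 hx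
        exact hxX (hNX v hvI x hxW ha)
      obtain ⟨_, ha, htv, _⟩ := hI v hvI
      have := wt_le_of_cap_zero htv (degIn_pos hv₀ ha.symm)
      rw [wt_eq_one h0]
      linarith
    · have ha : G.Adj v₀ v := by by_contra h; simp [hvI, h] at hv0
      simp only [if_neg hvI, if_pos ha]
      by_cases hb : IsBig (t v) (G.degIn W v)
      · have := wt_add_capDrop_le hb (hlt v ha)
        have := hmin v hvW hb
        linarith
      · have htv : 1 ≤ t v := by
          by_contra h
          have hd3 : G.degIn W v ≤ 3 := by unfold IsBig at hb; omega
          rcases hdom v (Finset.mem_filter.2 ⟨hvW, ha, by omega, hd3⟩) with h' | ⟨i, hi, hia⟩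
          · exact hvI h'
          · exact hvX (hNX i hi v hvW hia)
        have := wt_add_le_of_not_isBig htv hb (hlt v ha)
        linarith
  · intro y x₁ x₂ h _
    simp only [if_neg (hpos y h.cap.ge), if_neg (hpos x₁ h.cap₁), if_neg (hpos x₂ h.cap₂)]
    have dy := degIn_mono (G := G) hsub y
    have d₁ := degIn_mono (G := G) hsub x₁
    have d₂ := degIn_mono (G := G) hsub x₂
    rw [h.deg] at dy
    rw [h.deg₁] at d₁
    rw [h.deg₂] at d₂
    have hβ : ∀ v, (if G.Adj v₀ v then m else 0) ≤ 1 / 9 := by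
      intro v; split_ifs <;> linarith
    have e2 : ∀ x, 2 ≤ G.degIn W x → G.wt t W x + (if G.Adj v₀ x then m else 0) ≤ 7 / 9 := by
      intro x hx
      have := wt_le_two_thirds (t := t) hx
      linarith [hβ x]
    have e1 : ∀ x, G.degIn (W \ X) x = 1 → 1 ≤ G.degIn W x →
        G.wt t W x + (if G.Adj v₀ x then m else 0) ≤ 5 / 6 := by
      intro x hx hx'
      rcases Nat.eq_or_lt_of_le hx' with he | hl
      · have : ¬ G.Adj v₀ x := fun ha => by have := hlt x ha; omega
        rw [if_neg this]
        linarith [wt_le_five_sixths (t := t) hx']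
      · linarith [e2 x hl]
    have e3 : ∀ x, 1 ≤ t x → 2 ≤ G.degIn W x → ¬ (2 ≤ t x ∧ G.degIn W x = 2) →
        G.wt t W x + (if G.Adj v₀ x then m else 0) ≤ 11 / 18 := by
      intro x htx hx hn
      rcases Nat.eq_or_lt_of_le htx with ht1 | ht2
      · linarith [wt_le_of_cap_one ht1.symm hx, hβ x]
      · linarith [wt_le_half (G := G) (t := t) (W := W) (v := x) (by omega), hβ x]
    have f₁ := e1 x₁ h.deg₁ d₁
    have f₂ := e1 x₂ h.deg₂ d₂
    -- Centre of degree two: it gains nothing, and `4/9 + 7/9 + 7/9 = 2`. Degree three: it counts at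
    -- most `1/3 + 1/9`, and the two ends together at most `14/9`. Degree at least four: by
    -- minimality of `m` it counts at most `1/3`, and `1/3 + 5/6 + 5/6 = 2`.
    rcases Nat.lt_trichotomy (G.degIn W y) 3 with c | c | c
    · have hn : ¬ G.Adj v₀ y := fun ha => by have := hlt y ha; have := h.deg; omega
      rw [if_neg hn]
      have n₁ := hW.degIn_ne_one_of_adj (hsub h.mem) (hsub h.mem₁) h.cap (by omega) h.adj₁ h.cap₁
      have n₂ := hW.degIn_ne_one_of_adj (hsub h.mem) (hsub h.mem₂) h.cap (by omega) h.adj₂ h.cap₂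
      linarith [e2 x₁ (by omega), e2 x₂ (by omega), wt_le_of_cap_one h.cap dy]
    · have wy := wt_le_of_cap_one' h.cap c.ge
      have bβ := hβ y
      by_cases c₂ : G.degIn W x₂ = 1
      · have key := fun h' => hW.not_pendant_of_adj (hsub h.mem) (hsub h.mem₁) (hsub h.mem₂) h.cap
          c h.adj₁ h.adj₂ h.ne h.cap₂ c₂ h'
        have c₁ : G.degIn W x₁ ≠ 1 := fun e => key (Or.inl ⟨h.cap₁, e⟩)
        linarith [e3 x₁ h.cap₁ (by omega) fun e => key (Or.inr e)]
      · by_cases c₁ : G.degIn W x₁ = 1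
        · have key := fun h' => hW.not_pendant_of_adj (hsub h.mem) (hsub h.mem₂) (hsub h.mem₁)
            h.cap c h.adj₂ h.adj₁ h.ne.symm h.cap₁ c₁ h'
          linarith [e3 x₂ h.cap₂ (by omega) fun e => key (Or.inr e)]
        · linarith [e2 x₁ (by omega), e2 x₂ (by omega)]
    · have : G.wt t W y + (if G.Adj v₀ y then m else 0) ≤ 1 / 3 := by
        have hb : IsBig (t y) (G.degIn W y) := Or.inr (Or.inl ⟨h.cap, by omega⟩)
        have h1 := capWeight_add_capDrop_cap_one (d := G.degIn W y) (by omega)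
        have h2 := hmin y (hsub h.mem) hb
        have h3 := capDrop_nonneg (t y) (G.degIn W y)
        rw [h.cap] at h2 h3
        rw [wt, h.cap]
        split_ifs <;> linarith
      linarith
  · have hX : ∑ v ∈ X, G.wt t W v ≤
        G.wt t W v₀ + ∑ z ∈ I, ∑ x ∈ N z, G.wt t W x := by
      have hnot : v₀ ∉ I.biUnion N := by simp [N]
      rw [Finset.sum_insert hnot]
      have := sum_biUnion_le_of_nonneg I N (G.wt t W) (wt_nonneg W)
      linarith
    have hR : ∑ v ∈ W \ X, (if v ∈ I then (5 / 6 : ℝ) else if G.Adj v₀ v then m else 0) =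
        5 / 6 * I.card + m * (((W \ X) \ I).filter (G.Adj v₀)).card := by
      have hIR : I ⊆ W \ X := fun z hz => Finset.mem_sdiff.2 ⟨(hI z hz).1, hIX z hz⟩
      rw [← Finset.sum_sdiff hIR, add_comm]
      congr 1
      · rw [Finset.sum_congr rfl fun z hz => if_pos hz, Finset.sum_const, nsmul_eq_mul, mul_comm]
      · rw [Finset.sum_congr rfl fun z hz => if_neg (Finset.mem_sdiff.1 hz).2,
          ← Finset.sum_filter, Finset.sum_const, nsmul_eq_mul, mul_comm]
    have hcard : G.degIn W v₀ ≤
        I.card + (((W \ X) \ I).filter (G.Adj v₀)).card + ∑ z ∈ I, (N z).card := by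
      have hsub' : W.filter (G.Adj v₀) ⊆
          (I ∪ ((W \ X) \ I).filter (G.Adj v₀)) ∪ I.biUnion N := by
        intro x hx
        obtain ⟨hxW, ha⟩ := Finset.mem_filter.1 hx
        by_cases hxI : x ∈ I
        · simp [hxI]
        by_cases hxX : x ∈ X
        · exact Finset.mem_union_right _ ((Finset.mem_insert.1 hxX).resolve_left ha.ne')
        · refine Finset.mem_union_left _ (Finset.mem_union_right _ ?_)
          simp [hxW, hxI, hxX, ha]
      refine (Finset.card_le_card hsub').trans ((Finset.card_union_le _ _).trans ?_)
      gcongr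
      · exact Finset.card_union_le _ _
      · exact Finset.card_biUnion_le
    have hcard' : (G.degIn W v₀ : ℝ) ≤
        I.card + (((W \ X) \ I).filter (G.Adj v₀)).card + ∑ z ∈ I, ((N z).card : ℝ) := by
      exact_mod_cast hcard
    have hz : ∑ z ∈ I, (∑ x ∈ N z, (G.wt t W x + m) + m) ≤ ∑ z ∈ I, (5 / 6 : ℝ) := by
      apply Finset.sum_le_sum
      intro z hz
      obtain ⟨hzW, ha, htz, hdz⟩ := hI z hz
      exact hW.sum_nbrs_le hzW hv₀ htz hdz ha.symm hm hm9
    simp only [Finset.sum_add_distrib, Finset.sum_const, nsmul_eq_mul, ← Finset.sum_mul] at hz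
    have hw : G.wt t W v₀ = G.degIn W v₀ * m := by rw [wt, hb₀.capWeight_eq, hm]
    rw [hR]
    -- The weight of `v₀` is split into shares `m`, one per neighbour. Surviving neighbours outside
    -- `I` pay their own share; `hz` covers the shares of `I` and of its deleted neighbours, as well
    -- as the weights of the latter.
    nlinarith [mul_le_mul_of_nonneg_right hcard' hm0]

end IsStuck

theorem wt_le_one (W : Finset V) (v : V) : G.wt t W v ≤ 1 := capWeight_le_one _ _

/-! ### Reduction to maximum degree two -/

namespace IsStuck

variable {W : Finset V}

/-- Without big vertices, `z` has at most three neighbours, all of cap zero and weight at most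
`1/6`. Deleting them costs at most `1/2` and isolates `z`, a gain of `5/6`. -/
theorem degIn_eq_zero (hW : G.IsStuck t W) {z : V} (hz : z ∈ W) (ht : t z = 0) :
    G.degIn W z = 0 := by
  by_contra hd
  have hd3 : G.degIn W z ≤ 3 := by
    have := hW.not_isBig z hz
    unfold IsBig at this
    omega
  have hnb : ∀ x ∈ W, G.Adj z x → t x = 0 := by
    intro x hx ha
    by_contra htx
    exact hW.not_isBig x hx (hW.isBig_of_adj hz hx ht ha (by omega))
  have hzR : z ∈ W \ W.filter (G.Adj z) := by simp [hz]
  obtain ⟨u, hu, hau⟩ := exists_of_degIn_pos (Nat.pos_of_ne_zero hd)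
  refine hW.false_of_delete (X := W.filter (G.Adj z)) (Finset.filter_subset _ _)
    ⟨u, Finset.mem_filter.2 ⟨hu, hau⟩⟩ (fun v => if v = z then 5 / 6 else 0) ?_ ?_ ?_
  · intro v hv hv0
    obtain rfl : v = z := by by_contra h; simp [h] at hv0
    have h0 : G.degIn (W \ W.filter (G.Adj v)) v = 0 := by
      by_contra h
      obtain ⟨x, hx, ha⟩ := exists_of_degIn_pos (Nat.pos_of_ne_zero h)
      simp [ha] at hx
    rw [wt_eq_one h0, if_pos rfl]
    linarith [wt_le_of_cap_zero (G := G) (W := W) ht (by omega)]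
  · intro y x₁ x₂ h hs
    exfalso
    have key : ∀ v, 1 ≤ t v → ¬ (if v = z then (5 / 6 : ℝ) else 0) ≠ 0 := by
      intro v hv hne
      apply hne
      rw [if_neg]
      rintro rfl
      omega
    rcases hs with hs | hs | hs
    · exact key _ h.cap.ge hs
    · exact key _ h.cap₁ hs
    · exact key _ h.cap₂ hs
  · rw [Finset.sum_ite_eq', if_pos hzR]
    have : ∑ v ∈ W.filter (G.Adj z), G.wt t W v ≤ ∑ v ∈ W.filter (G.Adj z), (1 / 6 : ℝ) := by
      apply Finset.sum_le_sum
      intro x hx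
      obtain ⟨hx, ha⟩ := Finset.mem_filter.1 hx
      exact wt_le_of_cap_zero (hnb x hx ha) (degIn_pos hz ha.symm)
    rw [Finset.sum_const, nsmul_eq_mul] at this
    have h3 : ((W.filter (G.Adj z)).card : ℝ) ≤ 3 := by exact_mod_cast hd3
    linarith

theorem one_le_cap (hW : G.IsStuck t W) {x y : V} (hx : x ∈ W) (hy : y ∈ W) (ha : G.Adj x y) :
    1 ≤ t x := by
  by_contra h
  have := hW.degIn_eq_zero hx (by omega)
  have := degIn_pos hy ha
  omega

theorem degIn_le_three (hW : G.IsStuck t W) {x : V} (hx : x ∈ W) : G.degIn W x ≤ 3 := by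
  have := hW.not_isBig x hx
  unfold IsBig at this
  omega

theorem degIn_le_two (hW : G.IsStuck t W) {x : V} (hx : x ∈ W) (ht : t x = 1) :
    G.degIn W x ≤ 2 := by
  have := hW.not_isBig x hx
  unfold IsBig at this
  omega

/-- A neighbour of a vertex of cap one and degree two has degree at least two. -/
theorem two_le_degIn_of_adj (hW : G.IsStuck t W) {y x : V} (hy : y ∈ W) (hx : x ∈ W)
    (ht : t y = 1) (hd : G.degIn W y = 2) (ha : G.Adj y x) : 2 ≤ G.degIn W x := by
  have := hW.degIn_ne_one_of_adj hy hx ht hd ha (hW.one_le_cap hx hy ha.symm)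
  have := degIn_pos hy ha.symm
  omega

theorem cherry_degIn (hW : G.IsStuck t W) {R : Finset V} (hR : R ⊆ W) {y x₁ x₂ : V}
    (h : G.IsCherry t R y x₁ x₂) : G.degIn W y = 2 := by
  have := degIn_mono (G := G) hR y
  have := hW.degIn_le_two (hR h.mem) h.cap
  have := h.deg
  omega

theorem cherry_not_adj (hW : G.IsStuck t W) {R : Finset V} (hR : R ⊆ W) {y x₁ x₂ v : V}
    (h : G.IsCherry t R y x₁ x₂) (hv : v ∈ W) (hvR : v ∉ R) : ¬ G.Adj v y := by
  intro ha
  have := degIn_lt hR hv hvR ha.symm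
  have := hW.cherry_degIn hR h
  have := h.deg
  omega

/-- The reduction principle for the deletion of one vertex, with gains at its neighbours only. -/
theorem false_of_delete_vertex (hW : G.IsStuck t W) {v : V} (hv : v ∈ W) (β : V → ℝ)
    (h₀ : ∀ x, ¬ G.Adj v x → β x = 0)
    (h₁ : ∀ x ∈ W, G.Adj v x → G.wt t W x + β x ≤ G.wt t (W \ {v}) x)
    -- The centre is not adjacent to `v`, so it gains nothing and weighs at most `4/9`; the ends may
    -- use the remaining `14/9`.
    (h₂ : ∀ y x₁ x₂, G.IsCherry t (W \ {v}) y x₁ x₂ →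
      (G.wt t W x₁ + β x₁) + (G.wt t W x₂ + β x₂) ≤ 14 / 9)
    (hs : G.wt t W v ≤ ∑ x ∈ W.filter (G.Adj v), β x) : False := by
  refine hW.false_of_delete (X := {v}) (by simpa using hv) (by simp) β ?_ ?_ ?_
  · intro x hx hx0
    exact h₁ x (Finset.mem_sdiff.1 hx).1 (by by_contra h; exact hx0 (h₀ x h))
  · intro y x₁ x₂ h _
    have hn := hW.cherry_not_adj Finset.sdiff_subset h hv (by simp)
    have := wt_le_of_cap_one h.cap (hW.cherry_degIn Finset.sdiff_subset h).ge
    rw [h₀ y hn]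
    linarith [h₂ y x₁ x₂ h]
  · rw [Finset.sum_singleton]
    refine hs.trans_eq (Finset.sum_subset ?_ ?_)
    · intro x hx
      obtain ⟨hx, ha⟩ := Finset.mem_filter.1 hx
      simp [hx, ha.ne']
    · intro x hx hx'
      apply h₀
      intro ha
      exact hx' (Finset.mem_filter.2 ⟨(Finset.mem_sdiff.1 hx).1, ha⟩)

theorem filter_adj_eq {y a b : V} (hd : G.degIn W y = 2) (ha : a ∈ W) (hb : b ∈ W)
    (hya : G.Adj y a) (hyb : G.Adj y b) (hab : a ≠ b) : W.filter (G.Adj y) = {a, b} := by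
  ext x
  simp only [Finset.mem_filter, Finset.mem_insert, Finset.mem_singleton]
  constructor
  · rintro ⟨hx, h⟩
    exact eq_or_eq_of_degIn_le_two hd.le ha hb hx hya hyb h hab
  · rintro (rfl | rfl)
    · exact ⟨ha, hya⟩
    · exact ⟨hb, hyb⟩

theorem cherry_two_le (hW : G.IsStuck t W) {R : Finset V} (hR : R ⊆ W) {y x₁ x₂ : V}
    (h : G.IsCherry t R y x₁ x₂) : 2 ≤ G.degIn W x₁ ∧ 2 ≤ G.degIn W x₂ :=
  ⟨hW.two_le_degIn_of_adj (hR h.mem) (hR h.mem₁) h.cap (hW.cherry_degIn hR h) h.adj₁,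
    hW.two_le_degIn_of_adj (hR h.mem) (hR h.mem₂) h.cap (hW.cherry_degIn hR h) h.adj₂⟩

theorem wt_add_third_le {R : Finset V} {y : V} (ht : t y = 1) (hd : G.degIn W y = 2)
    (hR : G.degIn R y + 1 = G.degIn W y) : G.wt t W y + 1 / 3 ≤ G.wt t R y := by
  have : G.degIn R y = 1 := by omega
  rw [wt, wt, hd, this, ht, capWeight_one le_rfl, capWeight_cap_one le_rfl]
  norm_num

/-- Vertices of cap one and degree two are not adjacent. -/
theorem not_adj_of_cap_one (hW : G.IsStuck t W) {y y' : V} (hy : y ∈ W) (hy' : y' ∈ W)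
    (ht : t y = 1) (ht' : t y' = 1) (hd : G.degIn W y = 2) (hd' : G.degIn W y' = 2) :
    ¬ G.Adj y y' := by
  intro ha
  obtain ⟨x, hx, hax, hne⟩ := exists_ne_of_two_le_degIn hd.ge y'
  have hnb : ∀ u ∈ W, G.Adj y u → u = y' ∨ u = x := fun u hu h =>
    eq_or_eq_of_degIn_le_two hd.le hy' hx hu ha hax h hne.symm
  have e : ∀ u, 2 ≤ G.degIn W u →
      G.wt t W u + (if u = y' then 1 / 3 else if u = x then 1 / 9 else 0) ≤ 7 / 9 := by
    intro u hu
    split_ifs with h1 h2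
    · subst h1
      linarith [wt_le_of_cap_one ht' hu]
    · linarith [wt_le_two_thirds (t := t) hu]
    · linarith [wt_le_two_thirds (t := t) hu]
  -- `y` costs at most `4/9 = 1/3 + 1/9`. Only `1/9` of the available `1/6` is claimed at `x`, so
  -- that a cherry end counts at most `7/9`, half of `14/9`.
  refine hW.false_of_delete_vertex hy
    (fun u => if u = y' then 1 / 3 else if u = x then 1 / 9 else 0) ?_ ?_ ?_ ?_
  · intro u hu
    have h1 : u ≠ y' := by rintro rfl; exact hu ha
    have h2 : u ≠ x := by rintro rfl; exact hu hax
    simp [h1, h2]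
  · intro u hu hau
    have hs := degIn_sdiff_singleton hy hau.symm
    rcases hnb u hu hau with rfl | rfl
    · simpa using wt_add_third_le ht' hd' hs
    · have := wt_add_le_of_not_isBig (R := W \ {y}) (hW.one_le_cap hu hy hau.symm)
        (hW.not_isBig u hu) hs.le
      simp only [if_neg hne, if_true]
      linarith
  · intro s a b h
    obtain ⟨h1, h2⟩ := hW.cherry_two_le Finset.sdiff_subset h
    linarith [e a h1, e b h2]
  · rw [filter_adj_eq hd hy' hx ha hax hne.symm, Finset.sum_pair hne.symm]
    simp only [if_neg hne, if_true]
    linarith [wt_le_of_cap_one (G := G) ht hd.ge]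

/-- A vertex has at most one neighbour of cap one and degree two. -/
theorem eq_of_adj_of_cap_one (hW : G.IsStuck t W) {x y y' : V} (hx : x ∈ W) (hy : y ∈ W)
    (hy' : y' ∈ W) (ht : t y = 1) (ht' : t y' = 1) (hd : G.degIn W y = 2)
    (hd' : G.degIn W y' = 2) (ha : G.Adj x y) (ha' : G.Adj x y') : y = y' := by
  by_contra hne
  have e : ∀ u, 2 ≤ G.degIn W u →
      G.wt t W u + (if u = y ∨ u = y' then 1 / 3 else 0) ≤ 7 / 9 := by
    intro u hu
    split_ifs with h1
    · rcases h1 with rfl | rfl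
      · linarith [wt_le_of_cap_one ht hu]
      · linarith [wt_le_of_cap_one ht' hu]
    · linarith [wt_le_two_thirds (t := t) hu]
  -- `x` costs at most `2/3`, repaid by `1/3` at each of `y` and `y'`.
  refine hW.false_of_delete_vertex hx
    (fun u => if u = y ∨ u = y' then 1 / 3 else 0) ?_ ?_ ?_ ?_
  · intro u hu
    rw [if_neg]
    rintro (rfl | rfl)
    · exact hu ha
    · exact hu ha'
  · intro u hu hau
    have hs := degIn_sdiff_singleton hx hau.symm
    by_cases h : u = y ∨ u = y'
    · simp only [if_pos h]
      rcases h with rfl | rfl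
      · exact wt_add_third_le ht hd hs
      · exact wt_add_third_le ht' hd' hs
    · simpa [if_neg h] using wt_mono Finset.sdiff_subset u
  · intro s a b h
    obtain ⟨h1, h2⟩ := hW.cherry_two_le Finset.sdiff_subset h
    linarith [e a h1, e b h2]
  · have hsub : ({y, y'} : Finset V) ⊆ W.filter (G.Adj x) := by
      simp [Finset.insert_subset_iff, *]
    refine le_trans ?_ (Finset.sum_le_sum_of_subset_of_nonneg hsub fun u _ _ => by
      split_ifs <;> norm_num)
    rw [Finset.sum_pair hne]
    simp only [true_or, or_true, if_true]
    linarith [wt_le_two_thirds (t := t) (two_le_degIn hy hy' ha ha' hne)]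

theorem isCapped_path₃ {s b v : V} (hs : 1 ≤ t s) (hb : 2 ≤ t b) (hv : 1 ≤ t v)
    (hsv : ¬ G.Adj s v) : G.IsCapped t {s, b, v} := by
  have d₁ : G.degIn {s, b, v} s ≤ 1 := degIn_le_one_of_forall (u := b) (by
    intro x hx ha
    simp only [Finset.mem_insert, Finset.mem_singleton] at hx
    rcases hx with rfl | rfl | rfl
    · exact absurd rfl ha.ne
    · rfl
    · exact absurd ha hsv)
  have d₂ : G.degIn {s, b, v} b ≤ 2 := degIn_le_two_of_forall (u := s) (w := v) (by
    intro x hx ha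
    simp only [Finset.mem_insert, Finset.mem_singleton] at hx
    rcases hx with rfl | rfl | rfl
    · exact Or.inl rfl
    · exact absurd rfl ha.ne
    · exact Or.inr rfl)
  have d₃ : G.degIn {s, b, v} v ≤ 1 := degIn_le_one_of_forall (u := b) (by
    intro x hx ha
    simp only [Finset.mem_insert, Finset.mem_singleton] at hx
    rcases hx with rfl | rfl | rfl
    · exact absurd ha.symm hsv
    · rfl
    · exact absurd rfl ha.ne)
  refine ⟨?_, degenerate_insert (isCapped_pair (by omega) hv).degenerate d₁⟩
  intro x hx
  simp only [Finset.mem_insert, Finset.mem_singleton] at hx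
  rcases hx with rfl | rfl | rfl <;> omega

theorem isCapped_path₄ {s b v r : V} (hs : 1 ≤ t s) (hb : 2 ≤ t b) (hv : 2 ≤ t v) (hr : 1 ≤ t r)
    (hsv : ¬ G.Adj s v) (hsr : ¬ G.Adj s r) (hbr : ¬ G.Adj b r) : G.IsCapped t {s, b, v, r} := by
  have d₁ : G.degIn {s, b, v, r} s ≤ 1 := degIn_le_one_of_forall (u := b) (by
    intro x hx ha
    simp only [Finset.mem_insert, Finset.mem_singleton] at hx
    rcases hx with rfl | rfl | rfl | rfl
    · exact absurd rfl ha.ne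
    · rfl
    · exact absurd ha hsv
    · exact absurd ha hsr)
  have d₂ : G.degIn {s, b, v, r} b ≤ 2 := degIn_le_two_of_forall (u := s) (w := v) (by
    intro x hx ha
    simp only [Finset.mem_insert, Finset.mem_singleton] at hx
    rcases hx with rfl | rfl | rfl | rfl
    · exact Or.inl rfl
    · exact absurd rfl ha.ne
    · exact Or.inr rfl
    · exact absurd ha hbr)
  have d₃ : G.degIn {s, b, v, r} v ≤ 2 := degIn_le_two_of_forall (u := b) (w := r) (by
    intro x hx ha
    simp only [Finset.mem_insert, Finset.mem_singleton] at hx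
    rcases hx with rfl | rfl | rfl | rfl
    · exact absurd ha.symm hsv
    · exact Or.inl rfl
    · exact absurd rfl ha.ne
    · exact Or.inr rfl)
  have d₄ : G.degIn {s, b, v, r} r ≤ 1 := degIn_le_one_of_forall (u := v) (by
    intro x hx ha
    simp only [Finset.mem_insert, Finset.mem_singleton] at hx
    rcases hx with rfl | rfl | rfl | rfl
    · exact absurd ha.symm hsr
    · exact absurd ha.symm hbr
    · rfl
    · exact absurd rfl ha.ne)
  refine ⟨?_, degenerate_insert (isCapped_path₃ (by omega) hv hr hbr).degenerate d₁⟩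
  intro x hx
  simp only [Finset.mem_insert, Finset.mem_singleton] at hx
  rcases hx with rfl | rfl | rfl | rfl <;> omega

/-- This is the configuration that defeats the deletion of `v` in `degIn_ne_three`. With `r` the
third neighbour of `v`, remove `a, s, b, v, r` and keep the path `s b v`, extended by `r` if `r` is
pendant. The removed weight is at most `53/18 < 3`, or `56/18 < 4` for pendant `r`. -/
theorem not_four_cycle (hW : G.IsStuck t W) {v s a b : V} (hv : v ∈ W) (hs : s ∈ W) (ha : a ∈ W)
    (hb : b ∈ W) (htv : 2 ≤ t v) (hts : t s = 1) (hta : 2 ≤ t a) (htb : 2 ≤ t b)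
    (hdv : G.degIn W v = 3) (hds : G.degIn W s = 2) (hda : G.degIn W a = 2)
    (hdb : G.degIn W b = 2) (hab : a ≠ b) (hva : G.Adj v a) (hvb : G.Adj v b) (hsa : G.Adj s a)
    (hsb : G.Adj s b) : False := by
  have hsv : s ≠ v := by rintro rfl; omega
  have ns : ∀ u ∈ W, G.Adj s u → u = a ∨ u = b := fun u hu h =>
    eq_or_eq_of_degIn_le_two hds.le ha hb hu hsa hsb h hab
  have na : ∀ u ∈ W, G.Adj a u → u = s ∨ u = v := fun u hu h =>
    eq_or_eq_of_degIn_le_two hda.le hs hv hu hsa.symm hva.symm h hsv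
  have nb : ∀ u ∈ W, G.Adj b u → u = s ∨ u = v := fun u hu h =>
    eq_or_eq_of_degIn_le_two hdb.le hs hv hu hsb.symm hvb.symm h hsv
  have hnsv : ¬ G.Adj s v := by
    intro h
    rcases ns v hv h with rfl | rfl
    · exact hva.ne rfl
    · exact hvb.ne rfl
  obtain ⟨r, hr, hvr, hra, hrb⟩ : ∃ r ∈ W, G.Adj v r ∧ r ≠ a ∧ r ≠ b := by
    by_contra! h
    have : G.degIn W v ≤ 2 := degIn_le_two_of_forall (u := a) (w := b) fun x hx hax => by
      by_contra! hne
      exact hne.2 (h x hx hax hne.1)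
    omega
  have nv : ∀ u ∈ W, G.Adj v u → u = a ∨ u = b ∨ u = r := by
    intro u hu h
    by_contra! hne
    have hsub : ({u, a, b, r} : Finset V) ⊆ W.filter (G.Adj v) := by
      simp [Finset.insert_subset_iff, *]
    have := Finset.card_le_card hsub
    rw [Finset.card_insert_of_notMem (by simp [hne]),
      Finset.card_insert_of_notMem (by simp [hab, hra.symm]),
      Finset.card_pair hrb.symm] at this
    unfold degIn at hdv
    omega
  have hrs : r ≠ s := by rintro rfl; exact hnsv hvr.symm
  have hav := hva.ne'
  have hbv := hvb.ne'
  have hrv := hvr.ne'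
  have has := hsa.ne'
  have hbs := hsb.ne'
  have hY : ({a, s, b, v, r} : Finset V) ⊆ W := by simp [Finset.insert_subset_iff, *]
  have hsum : ∑ u ∈ ({a, s, b, v, r} : Finset V), G.wt t W u =
      G.wt t W a + (G.wt t W s + (G.wt t W b + (G.wt t W v + G.wt t W r))) := by
    rw [Finset.sum_insert (by simp [has, hab, hav, hra.symm]),
      Finset.sum_insert (by simp [hbs.symm, hsv, hrs.symm]),
      Finset.sum_insert (by simp [hbv, hrb.symm]),
      Finset.sum_pair hrv.symm]
  have wa := wt_le_two_thirds (t := t) hda.ge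
  have wb := wt_le_two_thirds (t := t) hdb.ge
  have ws := wt_le_of_cap_one (G := G) hts hds.ge
  have wv := wt_le_half (t := t) hdv.ge
  have wr := wt_le_five_sixths (t := t) (degIn_pos hv hvr.symm)
  have htr := hW.one_le_cap hr hv hvr.symm
  by_cases hdr : G.degIn W r = 1
  · have hcap := hasCapped_of_isCapped (isCapped_path₄ (G := G) (t := t) (s := s) (b := b)
      (v := v) (r := r) hts.ge htb htv htr hnsv
      (fun h => by rcases ns r hr h with h | h <;> contradiction)
      (fun h => by rcases nb r hr h with h | h <;> contradiction))
    rw [Finset.card_insert_of_notMem (by simp [hbs.symm, hsv, hrs.symm]),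
      Finset.card_insert_of_notMem (by simp [hbv, hrb.symm]), Finset.card_pair hrv.symm] at hcap
    refine hW.false_of_split_zero hY (by simp) (T := {s, b, v, r}) (by simp) ?_ hcap ?_
    · intro x hx u hu hxu
      simp only [Finset.mem_insert, Finset.mem_singleton] at hx ⊢
      rcases hx with rfl | rfl | rfl | rfl
      · rcases ns u hu hxu with h | h <;> simp [h]
      · rcases nb u hu hxu with h | h <;> simp [h]
      · rcases nv u hu hxu with h | h | h <;> simp [h]
      · have h := eq_of_degIn_le_one hdr.le hu hv hxu hvr.symm; simp [h]
    · rw [hsum]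
      push_cast
      linarith
  · have wr := wt_le_two_thirds (G := G) (t := t) (W := W) (v := r) (by
      have := degIn_pos hv hvr.symm
      omega)
    have hcap := hasCapped_of_isCapped (isCapped_path₃ (G := G) (t := t) (s := s) (b := b)
      (v := v) hts.ge htb (by omega) hnsv)
    rw [Finset.card_insert_of_notMem (by simp [hbs.symm, hsv]), Finset.card_pair hbv] at hcap
    refine hW.false_of_split_zero hY (by simp) (T := {s, b, v}) ?_ ?_ hcap ?_
    · intro x hx
      simp only [Finset.mem_insert, Finset.mem_singleton] at hx ⊢
      rcases hx with h | h | h <;> simp [h]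
    · intro x hx u hu hxu
      simp only [Finset.mem_insert, Finset.mem_singleton] at hx ⊢
      rcases hx with rfl | rfl | rfl
      · rcases ns u hu hxu with h | h <;> simp [h]
      · rcases nb u hu hxu with h | h <;> simp [h]
      · rcases nv u hu hxu with h | h | h <;> simp [h]
    · rw [hsum]
      push_cast
      linarith

/-- Deleting `v` costs at most `1/2` and gives `1/6` to each of its three neighbours. The ends of a
new cherry exceed `14/9` only if both are neighbours of `v` of cap at least two, and then
`not_four_cycle` applies. -/
theorem degIn_ne_three (hW : G.IsStuck t W) {v : V} (hv : v ∈ W) : G.degIn W v ≠ 3 := by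
  intro hd
  have htv : 2 ≤ t v := by
    rcases Nat.lt_trichotomy (t v) 1 with h | h | h
    · have := hW.degIn_eq_zero hv (by omega)
      omega
    · have := hW.degIn_le_two hv h
      omega
    · exact h
  refine hW.false_of_delete_vertex hv (fun u => if G.Adj v u then 1 / 6 else 0) ?_ ?_ ?_ ?_
  · intro u hu
    simp [hu]
  · intro u hu hau
    simp only [if_pos hau]
    exact wt_add_le_of_not_isBig (hW.one_le_cap hu hv hau.symm) (hW.not_isBig u hu)
      (degIn_sdiff_singleton hv hau.symm).le
  · intro s a b h
    have hsub : W \ {v} ⊆ W := Finset.sdiff_subset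
    obtain ⟨h1, h2⟩ := hW.cherry_two_le hsub h
    have hβ : ∀ u, (if G.Adj v u then (1 / 6 : ℝ) else 0) ≤ 1 / 6 := by
      intro u; split_ifs <;> norm_num
    have e : ∀ u, 1 ≤ t u → 2 ≤ G.degIn W u → ¬ (G.Adj v u ∧ 2 ≤ t u) →
        G.wt t W u + (if G.Adj v u then 1 / 6 else 0) ≤ 2 / 3 := by
      intro u htu hu hn
      by_cases ha : G.Adj v u
      · have := wt_le_of_cap_one (G := G) (W := W) (t := t) (v := u)
          (by by_contra h; exact hn ⟨ha, by omega⟩) hu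
        linarith [hβ u]
      · rw [if_neg ha]
        linarith [wt_le_two_thirds (t := t) hu]
    have wa := wt_le_two_thirds (t := t) h1
    have wb := wt_le_two_thirds (t := t) h2
    by_cases ca : G.Adj v a ∧ 2 ≤ t a
    · by_cases cb : G.Adj v b ∧ 2 ≤ t b
      · exfalso
        have da := degIn_sdiff_singleton hv ca.1.symm
        have db := degIn_sdiff_singleton hv cb.1.symm
        rw [h.deg₁] at da
        rw [h.deg₂] at db
        exact hW.not_four_cycle hv (hsub h.mem) (hsub h.mem₁) (hsub h.mem₂) htv h.cap ca.2 cb.2 hd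
          (hW.cherry_degIn hsub h) da.symm db.symm h.ne ca.1 cb.1 h.adj₁ h.adj₂
      · linarith [e b h.cap₂ h2 cb, hβ a]
    · linarith [e a h.cap₁ h1 ca, hβ b]
  · have : ∑ x ∈ W.filter (G.Adj v), (if G.Adj v x then (1 / 6 : ℝ) else 0) =
        ∑ x ∈ W.filter (G.Adj v), (1 / 6 : ℝ) :=
      Finset.sum_congr rfl fun x hx => if_pos (Finset.mem_filter.1 hx).2
    rw [this, Finset.sum_const, nsmul_eq_mul]
    have h3 : ((W.filter (G.Adj v)).card : ℝ) = 3 := by exact_mod_cast hd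
    rw [h3]
    linarith [wt_le_half (t := t) hd.ge]

open Classical in
/-- There is no stuck set. -/
theorem elim (hW : G.IsStuck t W) : False := by
  have hd2 : ∀ v ∈ W, G.degIn W v ≤ 2 := by
    intro v hv
    have := hW.degIn_le_three hv
    have := hW.degIn_ne_three hv
    omega
  obtain ⟨Y, hY⟩ : ∃ Y, Y = W.filter fun v => t v = 1 ∧ G.degIn W v = 2 := ⟨_, rfl⟩
  have hYW : Y ⊆ W := hY ▸ Finset.filter_subset _ _
  have hYm : ∀ {y}, y ∈ Y ↔ y ∈ W ∧ t y = 1 ∧ G.degIn W y = 2 := by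
    intro y; rw [hY, Finset.mem_filter]
  have hcap : ∀ v ∈ W \ Y, G.degIn W v ≤ t v ∧ (G.degIn W v = 2 → 2 ≤ t v) := by
    intro v hv
    obtain ⟨hvW, hvY⟩ := Finset.mem_sdiff.1 hv
    have := hd2 v hvW
    by_cases h0 : t v = 0
    · have := hW.degIn_eq_zero hvW h0
      omega
    · by_cases h1 : t v = 1
      · have : G.degIn W v ≠ 2 := fun h => hvY (hYm.2 ⟨hvW, h1, h⟩)
        omega
      · omega
  -- A minimal violation `T` is a cycle component of `G[W]`. Omitting one vertex leaves a capped
  -- path, and `2n/3 ≤ n - 1` for `n ≥ 3`.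
  have hdeg : ∀ T ⊆ W \ Y, T.Nonempty → ∃ v ∈ T, G.degIn T v ≤ 1 := by
    by_contra! hbad
    obtain ⟨T₀, hT₀, hT₀ne, hT₀d⟩ := hbad
    obtain ⟨T, hT, hmin⟩ := Finset.exists_min_image
      ((W \ Y).powerset.filter fun T => T.Nonempty ∧ ∀ v ∈ T, 1 < G.degIn T v) Finset.card
      ⟨T₀, by simp only [Finset.mem_filter, Finset.mem_powerset]; exact ⟨hT₀, hT₀ne, hT₀d⟩⟩
    simp only [Finset.mem_filter, Finset.mem_powerset] at hT hmin
    obtain ⟨hTY, ⟨v₀, hv₀⟩, hTd⟩ := hT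
    have hTW : T ⊆ W := hTY.trans Finset.sdiff_subset
    have hTdW : ∀ v ∈ T, G.degIn W v = 2 ∧ G.degIn T v = 2 := by
      intro v hv
      have := hd2 v (hTW hv)
      have := hTd v hv
      have := degIn_mono (G := G) hTW v
      omega
    have hT3 : 3 ≤ T.card := by
      have h1 : T.filter (G.Adj v₀) ⊆ T.erase v₀ := by
        intro x hx
        obtain ⟨hx, ha⟩ := Finset.mem_filter.1 hx
        exact Finset.mem_erase.2 ⟨ha.ne', hx⟩
      have h2 := Finset.card_le_card h1
      have h3 := (hTdW v₀ hv₀).2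
      rw [Finset.card_erase_of_mem hv₀] at h2
      unfold degIn at h3
      omega
    have hgood : G.IsCapped t (T \ {v₀}) := by
      refine ⟨?_, ?_⟩
      · intro v hv
        have hvT := (Finset.mem_sdiff.1 hv).1
        exact (degIn_mono (Finset.sdiff_subset.trans hTW) v).trans (hcap v (hTY hvT)).1
      · by_contra! h
        obtain ⟨U, hU, hUne, hUd⟩ := h
        have hUT : U ⊆ T := hU.trans Finset.sdiff_subset
        have := hmin U ⟨hUT.trans hTY, hUne, hUd⟩
        have h2 := Finset.card_le_card hU
        rw [Finset.card_sdiff_of_subset (by simpa using hv₀), Finset.card_singleton] at h2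
        omega
    have hr := hasCapped_of_isCapped hgood
    refine hW.false_of_split_zero hTW ⟨v₀, hv₀⟩ Finset.sdiff_subset ?_ hr ?_
    · intro a ha b hb hab
      by_contra hbT
      have haT := (Finset.mem_sdiff.1 ha).1
      have := degIn_lt hTW hb hbT hab
      have := hTdW a haT
      omega
    · have hle : ∑ v ∈ T, G.wt t W v ≤ ∑ v ∈ T, (2 / 3 : ℝ) :=
        Finset.sum_le_sum fun v hv => wt_le_two_thirds (hTdW v hv).1.ge
      rw [Finset.sum_const, nsmul_eq_mul] at hle
      rw [Finset.card_sdiff_of_subset (by simpa using hv₀), Finset.card_singleton,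
        Nat.cast_sub (by omega)]
      have : (3 : ℝ) ≤ T.card := by exact_mod_cast hT3
      push_cast
      linarith
  apply hW.not_hasCapped
  have hgood : G.IsCapped t (W \ Y) :=
    ⟨fun v hv => (degIn_mono Finset.sdiff_subset v).trans (hcap v hv).1, hdeg⟩
  refine (hasCapped_of_isCapped hgood).mono Finset.sdiff_subset ?_
  rw [Finset.card_sdiff_of_subset hYW, Nat.cast_sub (Finset.card_le_card hYW)]
  -- The closed neighbourhoods of `Y` are disjoint, and each has slack at least `5/9 + 1/3 + 1/3 >
  -- 1`, which pays for its omitted centre.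
  have key := sum_sum_closedNbhd_le (G := G) (R := W) (C := Y) (fun v => 1 - G.wt t W v)
    (fun v _ => by linarith [wt_le_one (G := G) (t := t) W v]) (by
    intro y hy y' hy' x hx hxy hxy'
    obtain ⟨hyW, hty, hdy⟩ := hYm.1 hy
    obtain ⟨hyW', hty', hdy'⟩ := hYm.1 hy'
    rcases hxy with rfl | hxy
    · rcases hxy' with rfl | hxy'
      · rfl
      · exact absurd hxy' (hW.not_adj_of_cap_one hyW' hyW hty' hty hdy' hdy)
    · rcases hxy' with rfl | hxy'
      · exact absurd hxy (hW.not_adj_of_cap_one hyW hyW' hty hty' hdy hdy')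
      · exact hW.eq_of_adj_of_cap_one hx hyW hyW' hty hty' hdy hdy' hxy.symm hxy'.symm)
  have low : ∑ y ∈ Y, (1 : ℝ) ≤ ∑ y ∈ Y, ∑ x ∈ W.filter (fun x => x = y ∨ G.Adj y x),
      (1 - G.wt t W x) := by
    apply Finset.sum_le_sum
    intro y hy
    obtain ⟨hyW, hty, hdy⟩ := hYm.1 hy
    obtain ⟨a, ha, hya⟩ := exists_of_degIn_pos (G := G) (W := W) (v := y) (by omega)
    obtain ⟨b, hb, hyb, hba⟩ := exists_ne_of_two_le_degIn hdy.ge a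
    have hsub : ({y, a, b} : Finset V) ⊆ W.filter (fun x => x = y ∨ G.Adj y x) := by
      simp [Finset.insert_subset_iff, *]
    refine le_trans ?_ (Finset.sum_le_sum_of_subset_of_nonneg hsub fun x _ _ => by
      linarith [wt_le_one (G := G) (t := t) W x])
    rw [Finset.sum_insert (by simp [hya.ne, hyb.ne]), Finset.sum_pair hba.symm]
    linarith [wt_le_of_cap_one (G := G) hty hdy.ge,
      wt_le_two_thirds (t := t) (hW.two_le_degIn_of_adj hyW ha hty hdy hya),
      wt_le_two_thirds (t := t) (hW.two_le_degIn_of_adj hyW hb hty hdy hyb)]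
  rw [Finset.sum_sub_distrib, Finset.sum_const, nsmul_eq_mul, mul_one] at key
  rw [Finset.sum_const, nsmul_eq_mul, mul_one] at low
  linarith

end IsStuck

/-- Every set `W` contains a capped set of size at least the potential of `W`. -/
theorem hasCapped_potential (G : SimpleGraph V) [DecidableRel G.Adj] (t : V → ℕ) (W : Finset V) :
    G.HasCapped t W (G.potential t W) := by
  induction W using Finset.strongInduction with
  | H W ih =>
  by_cases hch : ∃ y x₁ x₂, G.IsCherry t W y x₁ x₂
  · obtain ⟨y, x₁, x₂, h⟩ := hch
    have hn₁ := h.adj₁.ne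
    have hn₂ := h.adj₂.ne
    obtain ⟨R, hR⟩ : ∃ R, R = W \ {y, x₁, x₂} := ⟨_, rfl⟩
    have hsub : R ⊆ W := hR ▸ Finset.sdiff_subset
    have hT : ({y, x₁, x₂} : Finset V) ⊆ W := by
      simp [Finset.insert_subset_iff, h.mem, h.mem₁, h.mem₂]
    have hmem : ∀ {v}, v ∈ R ↔ v ∈ W ∧ v ≠ y ∧ v ≠ x₁ ∧ v ≠ x₂ := by
      intro v; simp [hR]
    have hclosed : ∀ a ∈ ({y, x₁, x₂} : Finset V), ∀ b ∈ R, ¬ G.Adj a b := by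
      intro a ha b hb hab
      obtain ⟨hbW, hby, hb₁, hb₂⟩ := hmem.1 hb
      simp only [Finset.mem_insert, Finset.mem_singleton] at ha
      rcases ha with rfl | rfl | rfl
      · rcases h.eq_or_eq hbW hab with h | h <;> contradiction
      · exact hby (h.eq_of_adj₁ hbW hab)
      · exact hby (h.symm.eq_of_adj₁ hbW hab)
    have hdeg : ∀ v ∈ R, G.degIn R v = G.degIn W v := by
      intro v hv
      apply degIn_congr
      intro x hx
      refine ⟨fun hx => hsub hx, fun hxW => ?_⟩
      by_contra hxR
      have : x ∈ ({y, x₁, x₂} : Finset V) := by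
        by_contra h'
        exact hxR (hR ▸ Finset.mem_sdiff.2 ⟨hxW, h'⟩)
      exact hclosed x this v hv hx.symm
    -- The two ends are kept: `2 = 19/9 - 1/9` is the contribution of the cherry to the potential.
    have hpair : G.HasCapped t {x₁, x₂} 2 := HasCapped.pair h.ne h.cap₁ h.cap₂
    have hpair : G.HasCapped t {y, x₁, x₂} 2 := hpair.mono (by simp) le_rfl
    have hss : R ⊂ W := hsub.ssubset_of_ne fun he => by
      have := h.mem
      rw [← he] at this
      exact (hmem.1 this).2.1 rfl
    have hunion := hpair.union (ih R hss) (hR ▸ Finset.disjoint_sdiff) hclosed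
    refine hunion.mono (Finset.union_subset hT hsub) ?_
    have hcenters : (G.cherryCenters t R).card + 1 ≤ (G.cherryCenters t W).card := by
      have hy : y ∈ G.cherryCenters t W := mem_cherryCenters.2 ⟨x₁, x₂, h⟩
      rw [← Finset.card_erase_add_one hy]
      gcongr
      intro v hv
      obtain ⟨a, b, h'⟩ := mem_cherryCenters.1 hv
      refine Finset.mem_erase.2 ⟨(hmem.1 h'.mem).2.1, mem_cherryCenters.2 ⟨a, b, ?_⟩⟩
      exact ⟨hsub h'.mem, hsub h'.mem₁, hsub h'.mem₂, h'.ne, h'.cap, h'.cap₁, h'.cap₂, h'.adj₁,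
        h'.adj₂, (hdeg _ h'.mem).symm.trans h'.deg, (hdeg _ h'.mem₁).symm.trans h'.deg₁,
        (hdeg _ h'.mem₂).symm.trans h'.deg₂⟩
    have hcenters' : ((G.cherryCenters t R).card : ℝ) + 1 ≤ (G.cherryCenters t W).card := by
      exact_mod_cast hcenters
    have hsum : ∑ v ∈ W, G.wt t W v = ∑ v ∈ R, G.wt t R v + 19 / 9 := by
      rw [← Finset.sum_sdiff hT, ← hR, ← h.sum_wt, Finset.sum_insert (by simp [hn₁, hn₂]),
        Finset.sum_pair h.ne, add_assoc]
      congr 1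
      exact Finset.sum_congr rfl fun v hv => by rw [wt, wt, hdeg v hv]
    unfold potential
    linarith
  · push Not at hch
    by_contra hno
    have hle : G.potential t W ≤ ∑ v ∈ W, G.wt t W v := by
      unfold potential
      have : (0 : ℝ) ≤ (G.cherryCenters t W).card / 9 := by positivity
      linarith
    exact IsStuck.elim ⟨ih, hch, fun h => hno (h.mono subset_rfl hle)⟩

end SimpleGraph

end CappedForests

/-! ### Excess weights against capped weights -/

/-- The excess weight of a vertex of degree `d` with `l` pendant neighbours is bounded by its
weight in the graph without the vertices of degree at most one. -/
theorem excess_le_capWeight {k d l c : ℕ} (hk : 2 ≤ k) (hd : 2 ≤ d) (hl : l ≤ k) (hc : c + l ≤ d) :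
    2 / ((d : ℝ) + 1) - l * (if d ≤ k then (0 : ℝ) else 2 / (((k : ℝ) + 1) * ((d : ℝ) + 1))) ≤
      capWeight (min 2 (k - l)) c ∧
    (min 2 (k - l) = 1 → c = 2 →
      2 / ((d : ℝ) + 1) - l * (if d ≤ k then (0 : ℝ) else 2 / (((k : ℝ) + 1) * ((d : ℝ) + 1))) ≤
        1 / 3) := by
  obtain ⟨e, he⟩ : ∃ e, e = 2 / ((d : ℝ) + 1) -
    l * (if d ≤ k then (0 : ℝ) else 2 / (((k : ℝ) + 1) * ((d : ℝ) + 1))) := ⟨_, rfl⟩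
  rw [← he]
  have hk' : (2 : ℝ) ≤ k := by exact_mod_cast hk
  have hd' : (2 : ℝ) ≤ d := by exact_mod_cast hd
  have hc' : (c : ℝ) + l ≤ d := by exact_mod_cast hc
  have hl' : (l : ℝ) ≤ k := by exact_mod_cast hl
  have hle : e ≤ 2 / ((d : ℝ) + 1) := by
    rw [he]
    have : 0 ≤ l * (if d ≤ k then (0 : ℝ) else 2 / (((k : ℝ) + 1) * ((d : ℝ) + 1))) := by
      split_ifs <;> positivity
    linarith
  have h23 : e ≤ 2 / 3 := hle.trans (by
    rw [div_le_div_iff₀ (by positivity) (by norm_num)]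
    linarith)
  have heq : ¬ d ≤ k → e = 2 * (k + 1 - l) / (((k : ℝ) + 1) * ((d : ℝ) + 1)) := by
    intro h
    rw [he, if_neg h]
    field_simp
  rcases Nat.eq_zero_or_pos c with rfl | hc0
  · refine ⟨?_, by omega⟩
    rw [capWeight_zero]
    linarith
  rcases Nat.lt_trichotomy (k - l) 1 with h | h | h
  · obtain rfl : l = k := by omega
    rw [Nat.sub_self, Nat.min_zero]
    refine ⟨?_, by omega⟩
    -- Here `e = 2/((k+1)(d+1))` with `k + 1 ≥ 3` and `d ≥ c + k ≥ c + 2`. This is where the factor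
    -- `2/3` of cap zero comes from.
    have h1 : e ≤ 2 / (3 * ((c : ℝ) + 3)) := by
      rw [heq (by omega), div_le_div_iff₀ (by positivity) (by positivity)]
      nlinarith
    have hc1 : (1 : ℝ) ≤ c := by exact_mod_cast hc0
    by_cases h3 : c ≤ 3
    · rw [capWeight_cap_zero hc0 h3]
      refine h1.trans ?_
      rw [div_le_div_iff₀ (by positivity) (by norm_num)]
      linarith
    · rw [capWeight_cap_zero_of_four_le (by omega)]
      refine h1.trans ?_
      gcongr
      norm_num
  · rw [h, show min 2 1 = 1 from rfl]
    by_cases h2 : 2 ≤ c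
    · have hlk : (l : ℝ) + 1 = k := by exact_mod_cast (by omega : l + 1 = k)
      -- Here `e = 4/((k+1)(d+1))` and `d ≥ c + 1`. At `c = 2` the bound is `1/3`, which cancels the
      -- cherry penalty.
      have h1 : e ≤ 4 / (3 * ((c : ℝ) + 2)) := by
        rw [heq (by omega), div_le_div_iff₀ (by positivity) (by positivity)]
        nlinarith
      constructor
      · rw [capWeight_cap_one h2]
        refine h1.trans ?_
        gcongr
        norm_num
      · rintro _ rfl
        norm_num at h1
        linarith
    · obtain rfl : c = 1 := by omega
      refine ⟨?_, by omega⟩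
      rw [capWeight_one le_rfl]
      linarith
  · rw [Nat.min_eq_left h]
    refine ⟨?_, by omega⟩
    by_cases h2 : 2 ≤ c
    · rw [capWeight_of_two_le le_rfl h2]
      refine hle.trans ?_
      gcongr
      have : (0 : ℝ) ≤ l := by positivity
      linarith
    · obtain rfl : c = 1 := by omega
      rw [capWeight_one (by norm_num)]
      linarith

/-- A vertex with more than `k` pendant neighbours has nonpositive excess weight. -/
theorem excess_nonpos {k d l : ℕ} (hl : k < l) (hd : l ≤ d) :
    2 / ((d : ℝ) + 1) - l * (if d ≤ k then (0 : ℝ) else 2 / (((k : ℝ) + 1) * ((d : ℝ) + 1))) ≤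
      0 := by
  rw [if_neg (by omega)]
  have hl' : (k : ℝ) + 1 ≤ l := by exact_mod_cast hl
  have : 2 / ((d : ℝ) + 1) - l * (2 / (((k : ℝ) + 1) * ((d : ℝ) + 1))) =
      -(2 * (l - (k + 1)) / (((k : ℝ) + 1) * ((d : ℝ) + 1))) := by
    field_simp
    ring
  rw [this]
  have : 0 ≤ 2 * ((l : ℝ) - (k + 1)) / (((k : ℝ) + 1) * ((d : ℝ) + 1)) :=
    div_nonneg (by linarith) (by positivity)
  linarith

/-! ### Recognising forests of caterpillars -/

namespace SimpleGraph

/-- A finite set of vertices spanned by a path that cannot be left towards `A`. -/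
theorem exists_saturated_path {V : Type*} [Finite V] [Nonempty V] (K : SimpleGraph V) (A : Set V)
    (hA : ∀ v ∈ A, ∀ x ∈ A, ∀ y ∈ A, ∀ z ∈ A, K.Adj v x → K.Adj v y → K.Adj v z →
      x = y ∨ x = z ∨ y = z) :
    ∃ (a b : V) (p : K.Walk a b), p.IsPath ∧
      ∀ s ∈ p.support, ∀ x ∈ A, K.Adj s x → x ∈ p.support := by
  have := Fintype.ofFinite V
  by_cases hne : A.Nonempty
  · obtain ⟨a₀, ha₀⟩ := hne
    -- A longest path inside `A` works: its ends cannot be extended, and an interior vertex already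
    -- has two neighbours in `A` on the path.
    let L : Set ℕ := {n | ∃ (a b : V) (p : K.Walk a b), p.IsPath ∧ (∀ s ∈ p.support, s ∈ A) ∧
      p.length = n}
    have hbdd : BddAbove L := by
      refine ⟨Fintype.card V, ?_⟩
      rintro n ⟨a, b, p, hp, _, rfl⟩
      exact hp.length_lt.le
    have hmem : sSup L ∈ L := Nat.sSup_mem ⟨0, a₀, a₀, Walk.nil, by simp, by simpa using ha₀, rfl⟩
      hbdd
    obtain ⟨a, b, p, hp, hpA, hlen⟩ := hmem
    have hmax : ∀ {a' b' : V} (q : K.Walk a' b'), q.IsPath → (∀ s ∈ q.support, s ∈ A) →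
        q.length ≤ p.length := fun q hq hqA => hlen ▸ le_csSup hbdd ⟨_, _, q, hq, hqA, rfl⟩
    refine ⟨a, b, p, hp, fun s hs x hx hsx => ?_⟩
    by_contra hxp
    obtain ⟨i, rfl, hi⟩ := Walk.mem_support_iff_exists_getVert.1 hs
    rcases Nat.eq_zero_or_pos i with rfl | hi0
    · rw [Walk.getVert_zero] at hsx
      have := hmax (Walk.cons hsx.symm p) (hp.cons hxp) (by
        intro s hs
        rcases List.mem_cons.1 (by simpa using hs) with rfl | hs
        · exact hx
        · exact hpA s hs)
      simp at this
    rcases Nat.eq_or_lt_of_le hi with rfl | hil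
    · rw [Walk.getVert_length] at hsx
      have := hmax (Walk.cons hsx.symm p.reverse) (hp.reverse.cons (by simpa using hxp)) (by
        intro s hs
        rcases List.mem_cons.1 (by simpa using hs) with rfl | hs
        · exact hx
        · exact hpA s (by simpa using hs))
      simp at this
    · have h1 : K.Adj (p.getVert i) (p.getVert (i + 1)) := p.adj_getVert_succ hil
      have h2 : K.Adj (p.getVert i) (p.getVert (i - 1)) := by
        have := p.adj_getVert_succ (i := i - 1) (by omega)
        rw [Nat.sub_add_cancel hi0] at this
        exact this.symm
      have m1 := p.getVert_mem_support (i + 1)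
      have m2 := p.getVert_mem_support (i - 1)
      rcases hA _ (hpA _ hs) _ hx _ (hpA _ m1) _ (hpA _ m2) hsx h1 h2 with h | h | h
      · exact hxp (h ▸ m1)
      · exact hxp (h ▸ m2)
      · have := hp.getVert_injOn (by simp; omega) (by simp; omega) h
        omega
  · obtain ⟨a⟩ := ‹Nonempty V›
    exact ⟨a, a, Walk.nil, by simp, fun s _ x hx => absurd ⟨x, hx⟩ hne⟩

/-- A tree is a caterpillar if the vertices outside of some set `A` have at most one neighbour and
the vertices of `A` have at most two neighbours in `A`. -/
theorem IsTree.isCaterpillar {V : Type*} [Finite V] {K : SimpleGraph V} (hK : K.IsTree) (A : Set V)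
    (h₁ : ∀ v, v ∉ A → ∀ x y, K.Adj v x → K.Adj v y → x = y)
    (h₂ : ∀ v ∈ A, ∀ x ∈ A, ∀ y ∈ A, ∀ z ∈ A, K.Adj v x → K.Adj v y → K.Adj v z →
      x = y ∨ x = z ∨ y = z) : K.IsCaterpillar := by
  have := hK.connected.nonempty
  obtain ⟨a, b, p, hp, hsat⟩ := exists_saturated_path K A h₂
  refine ⟨hK, a, b, p, hp, fun x hx => ?_⟩
  -- Invariant along walks that start on the path: every vertex met lies on it or is a vertex
  -- outside `A` attached to it.
  have key : ∀ {u v : V} (_ : K.Walk u v),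
      (u ∈ p.support ∨ (u ∉ A ∧ ∃ w ∈ p.support, K.Adj u w)) →
      (v ∈ p.support ∨ (v ∉ A ∧ ∃ w ∈ p.support, K.Adj v w)) := by
    intro u v q
    induction q with
    | nil => exact id
    | cons h q ih =>
      intro hu
      apply ih
      rcases hu with hu | ⟨huA, w, hw, huw⟩
      · rw [or_iff_not_imp_left]
        intro hn
        exact ⟨fun hA => hn (hsat _ hu _ hA h), _, hu, h.symm⟩
      · exact Or.inl (h₁ _ huA _ _ huw h ▸ hw)
  obtain ⟨q⟩ := hK.connected.preconnected a x
  obtain ⟨hxA, w, hw, hxw⟩ := (key q (Or.inl p.start_mem_support)).resolve_left hx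
  refine ⟨w, hw, ?_⟩
  ext y
  simp only [mem_neighborSet, Set.mem_singleton_iff]
  exact ⟨fun h => h₁ x hxA y w h hxw, fun h => h ▸ hxw⟩

/-- A graph with a set `A` as in `IsTree.isCaterpillar` is a forest of caterpillars. -/
theorem IsAcyclic.isForestOfCaterpillars {V : Type*} [Finite V] {H : SimpleGraph V}
    (hH : H.IsAcyclic) (A : Set V) (h₁ : ∀ v, v ∉ A → ∀ x y, H.Adj v x → H.Adj v y → x = y)
    (h₂ : ∀ v ∈ A, ∀ x ∈ A, ∀ y ∈ A, ∀ z ∈ A, H.Adj v x → H.Adj v y → H.Adj v z →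
      x = y ∨ x = z ∨ y = z) : H.IsForestOfCaterpillars := by
  refine ⟨hH, fun C => ?_⟩
  refine IsTree.isCaterpillar ⟨C.connected_toSimpleGraph, hH.induce _⟩ {v | v.1 ∈ A} ?_ ?_
  · intro v hv x y hx hy
    exact Subtype.ext (h₁ v.1 hv x.1 y.1 hx hy)
  · intro v hv x hx y hy z hz hvx hvy hvz
    rcases h₂ v.1 hv x.1 hx y.1 hy z.1 hz hvx hvy hvz with h | h | h
    · exact Or.inl (Subtype.ext h)
    · exact Or.inr (Or.inl (Subtype.ext h))
    · exact Or.inr (Or.inr (Subtype.ext h))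

/-- Every vertex of a cycle has two different neighbours on the cycle. -/
theorem Walk.IsCycle.exists_adj_adj {V : Type*} {H : SimpleGraph V} {a : V} {c : H.Walk a a}
    (hc : c.IsCycle) {u : V} (hu : u ∈ c.support) :
    ∃ x ∈ c.support, ∃ y ∈ c.support, x ≠ y ∧ H.Adj u x ∧ H.Adj u y := by
  obtain ⟨x, y, hxy, he⟩ := Set.ncard_eq_two.1 (hc.ncard_neighborSet_toSubgraph_eq_two hu)
  have hx : c.toSubgraph.Adj u x := by
    rw [← Subgraph.mem_neighborSet, he]; simp
  have hy : c.toSubgraph.Adj u y := by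
    rw [← Subgraph.mem_neighborSet, he]; simp
  exact ⟨x, (c.mem_verts_toSubgraph).1 hx.snd_mem, y, (c.mem_verts_toSubgraph).1 hy.snd_mem, hxy,
    hx.adj_sub, hy.adj_sub⟩

/-! ### Assembling the set -/

section

variable {V : Type*} [Fintype V] [DecidableEq V] (G : SimpleGraph V) [DecidableRel G.Adj]

/-- The number of neighbours of degree one. -/
def pendantDegree (v : V) : ℕ := G.degIn (Finset.univ.filter fun x => G.degree x = 1) v

theorem degIn_univ (v : V) : G.degIn Finset.univ v = G.degree v := by
  rw [degIn, ← card_neighborFinset_eq_degree, neighborFinset_eq_filter]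

theorem degIn_add_degIn_le {A B C : Finset V} (hA : A ⊆ C) (hB : B ⊆ C) (h : Disjoint A B)
    (v : V) : G.degIn A v + G.degIn B v ≤ G.degIn C v := by
  unfold degIn
  rw [← Finset.card_union_of_disjoint (Finset.disjoint_filter_filter h), ← Finset.filter_union]
  exact Finset.card_le_card (Finset.filter_subset_filter _ (Finset.union_subset hA hB))

theorem degIn_union_le (A B : Finset V) (v : V) :
    G.degIn (A ∪ B) v ≤ G.degIn A v + G.degIn B v := by
  unfold degIn
  rw [Finset.filter_union]
  exact Finset.card_union_le _ _

theorem degree_induce_coe (S : Finset V) (v : (S : Set V))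
    [Fintype ((G.induce (S : Set V)).neighborSet v)] :
    (G.induce (S : Set V)).degree v = G.degIn S v := by
  rw [← card_neighborFinset_eq_degree, degIn]
  refine Finset.card_bij (fun x _ => x.1) ?_ ?_ ?_
  · intro x hx
    simp only [mem_neighborFinset] at hx
    exact Finset.mem_filter.2 ⟨x.2, hx⟩
  · intro x _ y _ h
    exact Subtype.ext h
  · intro x hx
    obtain ⟨hx, ha⟩ := Finset.mem_filter.1 hx
    exact ⟨⟨x, hx⟩, by simpa using ha, rfl⟩

/-- The total weight in terms of the vertices of degree at most one and the excess weights of the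
other vertices. -/
theorem sum_caterpillarWeight_le (k : ℕ) :
    ∑ v, caterpillarWeight k G v ≤ ((Finset.univ.filter fun v => G.degree v ≤ 1).card : ℝ) +
      ∑ v ∈ Finset.univ.filter (fun v => 2 ≤ G.degree v), (2 / ((G.degree v : ℝ) + 1) -
        G.pendantDegree v * (if G.degree v ≤ k then (0 : ℝ)
          else 2 / (((k : ℝ) + 1) * ((G.degree v : ℝ) + 1)))) := by
  obtain ⟨pen, hpen⟩ : ∃ pen : V → ℝ, ∀ v, pen v = if G.degree v ≤ k then (0 : ℝ)
      else 2 / (((k : ℝ) + 1) * ((G.degree v : ℝ) + 1)) := ⟨_, fun _ => rfl⟩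
  have hpen0 : ∀ v, 0 ≤ pen v := by
    intro v; rw [hpen]; split_ifs <;> positivity
  simp only [← hpen]
  have hpt : ∀ v, caterpillarWeight k G v = (if G.degree v ≤ 1 then 1 else 0) +
      (if 2 ≤ G.degree v then 2 / ((G.degree v : ℝ) + 1) else 0) -
      (if G.degree v = 1 then ∑ w, if G.Adj v w then pen w else 0 else 0) := by
    intro v
    rcases Nat.lt_trichotomy (G.degree v) 1 with h | h | h
    · have h0 : G.degree v = 0 := by omega
      simp [caterpillarWeight, h0]
    · have hone : ∑ w ∈ G.neighborFinset v, (1 : ℝ) = 1 := by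
        rw [Finset.sum_const, card_neighborFinset_eq_degree, h]; simp
      have hsum : ∑ w, (if G.Adj v w then pen w else 0) = ∑ w ∈ G.neighborFinset v, pen w := by
        rw [← Finset.sum_filter, neighborFinset_eq_filter]
      rw [caterpillarWeight, if_neg (by omega), if_pos h, if_pos h.le, if_neg (by omega), if_pos h,
        hsum, add_zero]
      trans ∑ w ∈ G.neighborFinset v, (1 - pen w)
      · refine Finset.sum_congr rfl fun w _ => ?_
        rw [hpen]
        split_ifs <;> ring
      · rw [Finset.sum_sub_distrib, hone]
    · rw [caterpillarWeight, if_neg (by omega), if_neg (by omega), if_neg (by omega),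
        if_pos (by omega), if_neg (by omega)]
      ring
  -- Double counting of pairs (pendant vertex, neighbour). Pairs whose neighbour has degree at most
  -- one are discarded, hence an inequality.
  have hswap : ∑ v ∈ Finset.univ.filter (fun v => 2 ≤ G.degree v), G.pendantDegree v * pen v ≤
      ∑ v, (if G.degree v = 1 then ∑ w, if G.Adj v w then pen w else 0 else 0) := by
    calc _ ≤ ∑ w, G.pendantDegree w * pen w := by
          apply Finset.sum_le_sum_of_subset_of_nonneg (Finset.filter_subset _ _)
          intro v _ _
          exact mul_nonneg (Nat.cast_nonneg _) (hpen0 v)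
      _ = ∑ w, ∑ v ∈ Finset.univ.filter (fun x => G.degree x = 1),
            (if G.Adj v w then pen w else 0) := by
          refine Finset.sum_congr rfl fun w _ => ?_
          rw [← Finset.sum_filter, Finset.sum_const, nsmul_eq_mul, pendantDegree, degIn]
          simp only [G.adj_comm w]
      _ = _ := by
          rw [Finset.sum_comm, Finset.sum_filter]
  rw [Finset.sum_congr rfl fun v _ => hpt v, Finset.sum_sub_distrib, Finset.sum_add_distrib,
    Finset.sum_sub_distrib, ← Finset.sum_filter, ← Finset.sum_filter, Finset.sum_const,
    nsmul_eq_mul, mul_one]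
  linarith

/-- A capped set of vertices of degree at least two, together with all vertices of degree at most
one, induces a forest of caterpillars. -/
theorem IsCapped.isForestOfCaterpillars {t : V → ℕ} {S : Finset V} (hS : G.IsCapped t S)
    (ht : ∀ v, t v ≤ 2) :
    (G.induce ((Finset.univ.filter (fun v => G.degree v ≤ 1) ∪ S : Finset V) :
      Set V)).IsForestOfCaterpillars := by
  obtain ⟨U, hU⟩ : ∃ U, U = Finset.univ.filter (fun v => G.degree v ≤ 1) ∪ S := ⟨_, rfl⟩
  rw [← hU]
  have hmem : ∀ v ∈ U, v ∉ S → G.degree v ≤ 1 := by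
    intro v hv hvS
    rw [hU] at hv
    exact (Finset.mem_filter.1 ((Finset.mem_union.1 hv).resolve_right hvS)).2
  have hone : ∀ v ∈ U, v ∉ S → ∀ x y, G.Adj v x → G.Adj v y → x = y := by
    intro v hv hvS x y hx hy
    have := hmem v hv hvS
    rw [← degIn_univ] at this
    exact eq_of_degIn_le_one this (Finset.mem_univ _) (Finset.mem_univ _) hx hy
  refine IsAcyclic.isForestOfCaterpillars ?_ {v | v.1 ∈ S} ?_ ?_
  · intro a c hc
    obtain ⟨T, hT⟩ : ∃ T, T = c.support.toFinset.image Subtype.val := ⟨_, rfl⟩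
    have hTm : ∀ {v}, v ∈ T ↔ ∃ u ∈ c.support, u.1 = v := by
      intro v; simp [hT]
    have htwo : ∀ u ∈ c.support, ∃ x ∈ T, ∃ y ∈ T, x ≠ y ∧ G.Adj u.1 x ∧ G.Adj u.1 y := by
      intro u hu
      obtain ⟨x, hx, y, hy, hxy, hux, huy⟩ := hc.exists_adj_adj hu
      exact ⟨x.1, hTm.2 ⟨x, hx, rfl⟩, y.1, hTm.2 ⟨y, hy, rfl⟩, fun h => hxy (Subtype.ext h), hux,
        huy⟩
    -- Vertices outside `S` have at most one neighbour, so a cycle lies in `S`, against degeneracy.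
    have hTS : T ⊆ S := by
      intro v hv
      obtain ⟨u, hu, rfl⟩ := hTm.1 hv
      by_contra hn
      obtain ⟨x, _, y, _, hxy, hux, huy⟩ := htwo u hu
      exact hxy (hone u.1 u.2 hn x y hux huy)
    obtain ⟨v, hv, hd⟩ := hS.degenerate T hTS ⟨a.1, hTm.2 ⟨a, c.start_mem_support, rfl⟩⟩
    obtain ⟨u, hu, rfl⟩ := hTm.1 hv
    obtain ⟨x, hx, y, hy, hxy, hux, huy⟩ := htwo u hu
    exact hxy (eq_of_degIn_le_one hd hx hy hux huy)
  · intro v hv x y hx hy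
    exact Subtype.ext (hone v.1 v.2 hv x.1 y.1 hx hy)
  · intro v hv x hx y hy z hz hvx hvy hvz
    by_contra! hne
    have h2 := (hS.degIn_le v.1 hv).trans (ht v.1)
    rcases eq_or_eq_of_degIn_le_two h2 hx hy hz hvx hvy hvz fun h => hne.1 (Subtype.ext h) with
      h | h
    · exact hne.2.1 (Subtype.ext h.symm)
    · exact hne.2.2 (Subtype.ext h.symm)

/-- With all pendant vertices chosen, a vertex with `l` of them can afford `k - l` further
neighbours, and at most two for the spine to be a path; this dictates the caps. -/
theorem exists_forestOfCaterpillars (k : ℕ) (hk : 2 ≤ k) :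
    ∃ S : Finset V,
      (G.induce (S : Set V)).IsForestOfCaterpillars ∧
      (∀ v ∈ S, G.degIn S v ≤ k) ∧
      ∑ v : V, caterpillarWeight k G v ≤ (S.card : ℝ) := by
  obtain ⟨t, ht⟩ : ∃ t : V → ℕ, ∀ v, t v = min 2 (k - G.pendantDegree v) := ⟨_, fun _ => rfl⟩
  obtain ⟨W, hW⟩ : ∃ W : Finset V, W = Finset.univ.filter fun v =>
    2 ≤ G.degree v ∧ G.pendantDegree v ≤ k := ⟨_, rfl⟩
  have hWm : ∀ {v}, v ∈ W ↔ 2 ≤ G.degree v ∧ G.pendantDegree v ≤ k := by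
    intro v; simp [hW]
  obtain ⟨S, hSW, hS, hcard⟩ := hasCapped_potential G t W
  have hdisj : Disjoint (Finset.univ.filter fun v => G.degree v ≤ 1) S := by
    rw [Finset.disjoint_left]
    intro v hv hvS
    have := (hWm.1 (hSW hvS)).1
    have := (Finset.mem_filter.1 hv).2
    omega
  refine ⟨Finset.univ.filter (fun v => G.degree v ≤ 1) ∪ S,
    hS.isForestOfCaterpillars G fun v => by rw [ht]; exact min_le_left _ _, ?_, ?_⟩
  · intro v hv
    rcases Finset.mem_union.1 hv with hv | hv
    · have := (Finset.mem_filter.1 hv).2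
      rw [← degIn_univ] at this
      have := degIn_mono (G := G) (Finset.subset_univ
        (Finset.univ.filter (fun v => G.degree v ≤ 1) ∪ S)) v
      omega
    · refine (degIn_union_le G _ _ v).trans ?_
      have h1 : G.degIn (Finset.univ.filter fun v => G.degree v ≤ 1) v = G.pendantDegree v := by
        apply degIn_congr
        intro x hx
        simp only [Finset.mem_filter, Finset.mem_univ, true_and]
        have : 1 ≤ G.degree x := by
          rw [← degIn_univ]; exact degIn_pos (Finset.mem_univ v) hx.symm
        omega
      have h2 := hS.degIn_le v hv
      have h3 := (hWm.1 (hSW hv)).2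
      rw [ht] at h2
      omega
  · refine (G.sum_caterpillarWeight_le k).trans ?_
    rw [Finset.card_union_of_disjoint hdisj]
    push_cast
    gcongr
    refine le_trans ?_ hcard
    have hpd : ∀ v, G.pendantDegree v ≤ G.degree v := by
      intro v
      rw [← degIn_univ]
      exact degIn_mono (Finset.subset_univ _) v
    have hc : ∀ v, G.degIn W v + G.pendantDegree v ≤ G.degree v := by
      intro v
      rw [← degIn_univ]
      apply G.degIn_add_degIn_le (Finset.subset_univ _) (Finset.subset_univ _)
      rw [Finset.disjoint_left]
      intro x hx hx'
      have := (hWm.1 hx).1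
      have := (Finset.mem_filter.1 hx').2
      omega
    have hsub : W ⊆ Finset.univ.filter (fun v => 2 ≤ G.degree v) := by
      intro v hv
      simpa using (hWm.1 hv).1
    rw [← Finset.sum_sdiff hsub]
    have hneg := Finset.sum_nonpos
      (s := Finset.univ.filter (fun v => 2 ≤ G.degree v) \ W)
      (f := fun v => 2 / ((G.degree v : ℝ) + 1) - G.pendantDegree v *
        (if G.degree v ≤ k then (0 : ℝ)
          else 2 / (((k : ℝ) + 1) * ((G.degree v : ℝ) + 1)))) (by
      intro v hv
      apply excess_nonpos _ (hpd v)
      by_contra h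
      simp only [Finset.mem_sdiff, Finset.mem_filter, Finset.mem_univ, true_and] at hv
      exact hv.2 (hWm.2 ⟨hv.1, by omega⟩))
    have hex : ∀ v ∈ W, _ := fun v hv =>
      excess_le_capWeight hk (hWm.1 hv).1 (hWm.1 hv).2 (hc v)
    simp only [← ht] at hex
    have hpot := sum_le_potential (G := G) (t := t) (R := W)
      (fun v => 2 / ((G.degree v : ℝ) + 1) - G.pendantDegree v *
        (if G.degree v ≤ k then (0 : ℝ)
          else 2 / (((k : ℝ) + 1) * ((G.degree v : ℝ) + 1)))) (fun v hv => (hex v hv).1) (by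
      intro y x₁ x₂ h
      -- The excesses on a cherry sum to at most `1/3 + 5/6 + 5/6 = 2`.
      have hy := (hex y h.mem).2 h.cap h.deg
      have h₁ := (hex x₁ h.mem₁).1
      have h₂ := (hex x₂ h.mem₂).1
      rw [h.deg₁, capWeight_one h.cap₁] at h₁
      rw [h.deg₂, capWeight_one h.cap₂] at h₂
      linarith)
    linarith

end

end SimpleGraph

theorem mainTheorem5 (k : ℕ) (hk : 2 ≤ k) {V : Type*} [Fintype V] (G : SimpleGraph V)
    [DecidableRel G.Adj] :
    ∃ S : Finset V,
      (G.induce (S : Set V)).IsForestOfCaterpillars ∧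
      (G.induce (S : Set V)).maxDegree ≤ k ∧
      ∑ v : V, caterpillarWeight k G v ≤ (S.card : ℝ) := by
  classical
  obtain ⟨S, hforest, hdeg, hcard⟩ := G.exists_forestOfCaterpillars k hk
  refine ⟨S, hforest, ?_, hcard⟩
  refine SimpleGraph.maxDegree_le_of_forall_degree_le _ _ fun v => ?_
  rw [G.degree_induce_coe S v]
  exact hdeg v.1 v.2
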